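/- Let $D\ge 1$ and $R\ge 0$ be integers and let $c_D>0$, $c_0>0$. There is a constant $K>0$, depending only on $D$, $c_D$, $R$ and $c_0$, such that the following holds. Let $\mathcal X$ be a finite non-empty set of $N=|\mathcal X|$ sites with a metric $d:\mathcal X\times\mathcal X\to\mathbb N$ such that $|\{i\in\mathcal X : d(i,j)=\ell\}|\le c_D\,\ell^{D-1}$ for every $j\in\mathcal X$ and every integer $\ell\ge 1$. Let $\mathcal H=\bigotimes_{i\in\mathcal X}\mathcal H_i$ with finite-dimensional Hilbert spaces $\mathcal H_i$ (of arbitrary dimensions), and let $\rho=\bigotimes_{i\in\mathcal X}\rho_i$, where each $\rho_i$ is a density matrix on $\mathcal H_i$; write $\langle A\rangle_\rho=\operatorname{Tr}(A\rho)$. Let $H=\sum_{j\in\mathcal X}h_j$ be a self-adjoint operator on $\mathcal H$ such that, for every $j$, the term $h_j$ acts trivially on all sites at distance larger than $R$ from $j$ and has operator norm $\|h_j\|\le E$, where $E>0$. Assume that the variance $\sigma_H^2=\langle (H-\langle H\rangle_\rho)^2\rangle_\rho$ satisfies $\sigma_H^2\ge c_0E^2N$. Put $$\widehat H=\frac1{\sigma_H}\sum_{j\in\mathcal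 X}\bigl(h_j-\langle h_j\rangle_\rho\bigr)=\sum_n \hat e_n\,|n\rangle\langle n|,\qquad F_{\widehat H}(y)=\sum_{n:\,\hat e_n\le y}\langle n|\rho|n\rangle ,$$ where $(|n\rangle)$ is an orthonormal eigenbasis of $\widehat H$, and let $G(y)=\frac1{\sqrt{2\pi}}\int_{-\infty}^y e^{-x^2/2}\,dx$. Then $$\sup_{y\in\mathbb R}\,\bigl|F_{\widehat H}(y)-G(y)\bigr|\le\frac{K}{\sqrt N}.$$ -/

import Mathlib

open scoped ComplexOrder Matrix.Norms.L2Operator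

universe u v

noncomputable section

namespace QuantumLattice

/-- The laws of a metric with values in the natural numbers. -/
structure IsLatticeMetric {X : Type u} (d : X → X → ℕ) : Prop where
  eq_zero_iff : ∀ i j, d i j = 0 ↔ i = j
  symm : ∀ i j, d i j = d j i
  triangle : ∀ i j k, d i k ≤ d i j + d j k

/-- Spheres of radius `ℓ ≥ 1` contain at most `cD * ℓ ^ (D - 1)` sites (used with `D ≥ 1`). -/
def HasDimensionBound {X : Type u} [Fintype X] (d : X → X → ℕ) (D : ℕ) (cD : ℝ) : Prop :=
  ∀ (j : X) (ℓ : ℕ), 1 ≤ ℓ →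
    ((Finset.univ.filter (fun i => d i j = ℓ)).card : ℝ) ≤ cD * (ℓ : ℝ) ^ (D - 1)

/-- Density matrices. -/
def IsState {n : Type v} [Fintype n] (ρ : Matrix n n ℂ) : Prop :=
  ρ.PosSemidef ∧ ρ.trace = 1

section Operators

variable {X : Type u} {κ : X → Type v}

/-- Operators on the tensor product over `i : X` of the Hilbert spaces `ℂ ^ (κ i)`, written as
matrices in the product basis, which is indexed by the configurations `∀ i, κ i`. -/
abbrev Operator (κ : X → Type v) : Type (max u v) :=
  Matrix (∀ i, κ i) (∀ i, κ i) ℂ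

open Classical in
/-- The operator `B ⊗ 1`, where `B` acts on the sites in `S` and `1` on the remaining ones. -/
def extendOperator (S : Set X) (B : Operator (fun i : S => κ i)) : Operator κ :=
  fun x y => if ∀ i, i ∉ S → x i = y i then B (fun i => x i) (fun i => y i) else 0

/-- `A` acts trivially on all sites outside `S`. -/
def SupportedOn (S : Set X) (A : Operator κ) : Prop :=
  ∃ B : Operator (fun i : S => κ i), A = extendOperator S B

/-- `A` acts trivially on all sites at distance larger than `R` from the site `j`. -/
def IsLocalAt (d : X → X → ℕ) (R : ℕ) (j : X) (A : Operator κ) : Prop :=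
  SupportedOn {i | d i j ≤ R} A

/-- The tensor product of the matrices `ρ i`. -/
def productState [Fintype X] (ρ : ∀ i, Matrix (κ i) (κ i) ℂ) : Operator κ :=
  fun x y => ∏ i, ρ i (x i) (y i)

theorem productState_isHermitian [Fintype X] {ρ : ∀ i, Matrix (κ i) (κ i) ℂ}
    (hρ : ∀ i, (ρ i).IsHermitian) : (productState ρ).IsHermitian := by
  ext x y
  simp only [Matrix.conjTranspose_apply, productState, star_prod]
  exact Finset.prod_congr rfl fun i _ => (hρ i).apply (x i) (y i)

end Operators

section Statistics

variable {n : Type v} [Fintype n] [DecidableEq n]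

/-- The average of `A` in the state `ρ`. -/
def average (ρ A : Matrix n n ℂ) : ℂ := (A * ρ).trace

/-- The variance of `H` in the state `ρ` (the average below is real for self-adjoint `H`, `ρ`). -/
def variance (ρ H : Matrix n n ℂ) : ℝ :=
  (average ρ ((H - average ρ H • (1 : Matrix n n ℂ)) ^ 2)).re

/-- The standard deviation of `H` in the state `ρ`. -/
def stdDev (ρ H : Matrix n n ℂ) : ℝ := Real.sqrt (variance ρ H)

/-- The cumulative distribution of the measurement of a self-adjoint `A` in the state `ρ`: the sum
of `⟨v, ρ v⟩` over the vectors `v` of an orthonormal eigenbasis of `A` with eigenvalue `≤ y`. -/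
def cumulative (ρ : Matrix n n ℂ) {A : Matrix n n ℂ} (hA : A.IsHermitian) (y : ℝ) : ℝ :=
  ∑ k with hA.eigenvalues k ≤ y,
    (star (⇑(hA.eigenvectorBasis k)) ⬝ᵥ ρ.mulVec (⇑(hA.eigenvectorBasis k))).re

/-- The Hamiltonian with local terms `h j`. -/
def hamiltonian {X : Type u} [Fintype X] (h : X → Matrix n n ℂ) : Matrix n n ℂ := ∑ j, h j

/-- The Hamiltonian with all its terms centred, divided by its standard deviation. -/
def standardized {X : Type u} [Fintype X] (ρ : Matrix n n ℂ) (h : X → Matrix n n ℂ) :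
    Matrix n n ℂ :=
  ((stdDev ρ (hamiltonian h) : ℂ))⁻¹ • ∑ j, (h j - average ρ (h j) • (1 : Matrix n n ℂ))

theorem standardized_isHermitian {X : Type u} [Fintype X] {ρ : Matrix n n ℂ}
    {h : X → Matrix n n ℂ} (hρ : ρ.IsHermitian) (hH : (hamiltonian h).IsHermitian) :
    (standardized ρ h).IsHermitian := by
  have hsum : ∑ j, (h j - average ρ (h j) • (1 : Matrix n n ℂ))
      = hamiltonian h - average ρ (hamiltonian h) • (1 : Matrix n n ℂ) := by
    simp only [hamiltonian, average, Finset.sum_sub_distrib, Finset.sum_mul, Matrix.trace_sum,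
      Finset.sum_smul]
  have hreal : star (average ρ (hamiltonian h)) = average ρ (hamiltonian h) := by
    rw [average, ← Matrix.trace_conjTranspose, Matrix.conjTranspose_mul, hρ.eq, hH.eq,
      Matrix.trace_mul_comm]
  unfold Matrix.IsHermitian standardized
  rw [hsum, Matrix.conjTranspose_smul, Matrix.conjTranspose_sub, Matrix.conjTranspose_smul,
    Matrix.conjTranspose_one, hH.eq, hreal]
  congr 1
  simp

end Statistics

/-- The cumulative distribution of the standard Gaussian. -/
def gaussianCumulative (y : ℝ) : ℝ :=
  (Real.sqrt (2 * Real.pi))⁻¹ * ∫ x in Set.Iic y, Real.exp (-x ^ 2 / 2)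

/-- The Kolmogorov distance, a supremum in `[0, ∞]`. -/
def kolmogorovDist (F G : ℝ → ℝ) : ENNReal := ⨆ y : ℝ, ENNReal.ofReal |F y - G y|

end QuantumLattice

end

/-! Let `Z w U` be the expectation of exp(w Σ_{j ∈ U} h'_j), where h'_j is the centred term h_j
divided by σ_H. For the full set of sites it is the moment generating function of the outcome of
measuring Ĥ. The heart of the proof is that `Z w U` has no zero for |w| < b√N, with b independent of
N and of the system.

On that disc every ‖w h'_j‖ is at most a small constant, because σ_H ≥ √c₀ E √N. Two facts then
suffice. Iterated differences of U ↦ `Z w U` over a set A are bounded by η^|A| with η small; this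
needs no commutativity (`norm_altSum_exp_le`). Moreover `Z w` factorizes over families of terms more
than 2R apart, because the state is a product. An induction in the style of cluster expansions
(`norm_insert_sub_le`) deduces |Z(U ∪ {j}) / Z(U) − 1| ≤ 1/2.

Adding the sites one at a time and summing the logarithms of these ratios yields an analytic L with
exp L = Z and |L| ≤ N (`exists_log_of_norm_insert_sub_le`). Mean zero and variance one give L(w) =
w²/2 + o(w²), so the Schwarz lemma on the disc of radius b√N improves this to |L(w) − w²/2| ≤
C|w|³/√N (`norm_log_mgf_sub_le`). For w = it this compares characteristic functions up to t = τ√N,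
and Esseen's inequality (`exists_abs_cdf_sub_le_of_charFun`), proved by smoothing with the Fejér
kernel, turns it into a bound of order 1/√N on distribution functions. -/

namespace QuantumLattice

/-! ### Slow variation of almost multiplicative set functions. -/

section ClusterExpansion

variable {X : Type u} [DecidableEq X]

/-- The iterated difference of a set function `Z` at `U` in the directions `A`. -/
def altSum {M : Type*} [AddCommGroup M] (Z : Finset X → M) (A U : Finset X) : M :=
  ∑ B ∈ A.powerset, (-1 : ℤ) ^ (A \ B).card • Z (B ∪ U)

theorem altSum_empty {M : Type*} [AddCommGroup M] (Z : Finset X → M) (U : Finset X) :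
    altSum Z ∅ U = Z U := by
  simp [altSum]

theorem altSum_insert {M : Type*} [AddCommGroup M] (Z : Finset X → M) {A : Finset X} {k : X}
    (hk : k ∉ A) (U : Finset X) :
    altSum Z (insert k A) U = altSum Z A (insert k U) - altSum Z A U := by
  unfold altSum
  rw [Finset.sum_powerset_insert hk, add_comm, sub_eq_add_neg, ← Finset.sum_neg_distrib]
  refine congrArg₂ _ (Finset.sum_congr rfl fun B hB => ?_) (Finset.sum_congr rfl fun B hB => ?_)
  · rw [Finset.insert_sdiff_insert, Finset.sdiff_insert_of_notMem hk, Finset.insert_union,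
      Finset.union_insert]
  · have hkB : k ∉ B := fun h => hk (Finset.mem_powerset.1 hB h)
    rw [Finset.insert_sdiff_of_notMem _ hkB, Finset.card_insert_of_notMem
      (by simp [hk]), pow_succ]
    simp

/-- Points of U are removed one by one. If U has no neighbour of A, the difference factorizes.
Otherwise a neighbour k is removed, leaving the differences over A and over A ∪ {k}. Two terms, and
a loss of 2 from `hn`, make the factor 4 per neighbour; passing to A ∪ {k} creates at most Δ new
neighbours, and the extra factor η pays for their 4 ^ Δ. -/
theorem norm_altSum_le_of_forall_erase {Z : Finset X → ℂ} {adj : X → X → Prop}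
    [DecidableRel adj] {Δ : ℕ} {η : ℝ} (hη : 0 ≤ η) (hη' : η * 4 ^ Δ ≤ 1)
    (hmul : ∀ A U, (∀ a ∈ A, ∀ b ∈ U, ¬ adj a b) → Z (A ∪ U) = Z A * Z U)
    (hdeg : ∀ (j : X) (U : Finset X), (U.filter (adj j)).card ≤ Δ)
    (hW : ∀ A, ‖altSum Z A ∅‖ ≤ η ^ A.card) (n : ℕ)
    (hn : ∀ (U : Finset X) (k : X), U.card < n → k ∉ U → ‖Z U‖ ≤ 2 * ‖Z (insert k U)‖)
    (U : Finset X) (hU : U.card ≤ n) (A : Finset X) (hAU : Disjoint A U) :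
    ‖altSum Z A U‖ ≤ η ^ A.card * 4 ^ (U.filter fun b => ∃ a ∈ A, adj a b).card * ‖Z U‖ := by
  induction U using Finset.strongInduction generalizing A with
  | H U ih =>
  rcases Finset.eq_empty_or_nonempty (U.filter fun b => ∃ a ∈ A, adj a b) with h0 | ⟨k, hk⟩
  · have hna : ∀ a ∈ A, ∀ b ∈ U, ¬ adj a b := by
      intro a ha b hb hab
      have : b ∈ U.filter fun b => ∃ a ∈ A, adj a b := by
        simp only [Finset.mem_filter]
        exact ⟨hb, a, ha, hab⟩
      simp [h0] at this
    have : altSum Z A U = altSum Z A ∅ * Z U := by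
      unfold altSum
      rw [Finset.sum_mul]
      refine Finset.sum_congr rfl fun B hB => ?_
      rw [hmul B U fun a ha => hna a (Finset.mem_powerset.1 hB ha), Finset.union_empty,
        smul_mul_assoc]
    rw [this, norm_mul, h0]
    simpa using mul_le_mul_of_nonneg_right (hW A) (norm_nonneg _)
  · obtain ⟨hkU, a, ha, hak⟩ := Finset.mem_filter.1 hk
    obtain ⟨U', hkU', rfl⟩ : ∃ U', k ∉ U' ∧ insert k U' = U :=
      ⟨U.erase k, Finset.notMem_erase _ _, Finset.insert_erase hkU⟩
    have hkA : k ∉ A := fun h => Finset.disjoint_left.1 hAU h hkU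
    have hcard : U'.card + 1 ≤ n := by rwa [Finset.card_insert_of_notMem hkU'] at hU
    have hdisj : Disjoint A U' := hAU.mono_right (Finset.subset_insert _ _)
    have h1 := ih U' (Finset.ssubset_insert hkU') (by omega) A hdisj
    have h2 := ih U' (Finset.ssubset_insert hkU') (by omega) (insert k A)
      (Finset.disjoint_insert_left.2 ⟨hkU', hdisj⟩)
    have hZ := hn U' k (by omega) hkU'
    set m := (U'.filter fun b => ∃ a ∈ A, adj a b).card with hm
    have hm1 : ((insert k U').filter fun b => ∃ a ∈ A, adj a b).card = m + 1 := by
      rw [Finset.filter_insert, if_pos ⟨a, ha, hak⟩, Finset.card_insert_of_notMem (by simp [hkU'])]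
    have hm2 : (U'.filter fun b => ∃ a ∈ insert k A, adj a b).card ≤ m + Δ := by
      refine le_trans (Finset.card_le_card (t := (U'.filter fun b => ∃ a ∈ A, adj a b) ∪
        U'.filter (adj k)) ?_) ((Finset.card_union_le _ _).trans (by gcongr; exact hdeg k U'))
      intro b hb
      simp only [Finset.mem_filter, Finset.mem_insert, exists_eq_or_imp, Finset.mem_union] at hb ⊢
      rcases hb with ⟨hb, h | h⟩
      exacts [Or.inr ⟨hb, h⟩, Or.inl ⟨hb, h⟩]
    have hsplit : altSum Z A (insert k U') = altSum Z (insert k A) U' + altSum Z A U' := by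
      rw [altSum_insert Z hkA]; abel
    rw [hsplit, hm1]
    rw [Finset.card_insert_of_notMem hkA] at h2
    have h3 : η ^ (A.card + 1) * 4 ^ (U'.filter fun b => ∃ a ∈ insert k A, adj a b).card
        ≤ η ^ A.card * 4 ^ m := by
      calc η ^ (A.card + 1) * 4 ^ (U'.filter fun b => ∃ a ∈ insert k A, adj a b).card
          ≤ η ^ (A.card + 1) * 4 ^ (m + Δ) := by gcongr; norm_num
        _ = η ^ A.card * 4 ^ m * (η * 4 ^ Δ) := by ring
        _ ≤ η ^ A.card * 4 ^ m * 1 := by gcongr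
        _ = _ := mul_one _
    calc _ ≤ ‖altSum Z (insert k A) U'‖ + ‖altSum Z A U'‖ := norm_add_le _ _
      _ ≤ η ^ A.card * 4 ^ m * ‖Z U'‖ + η ^ A.card * 4 ^ m * ‖Z U'‖ :=
        add_le_add (h2.trans (mul_le_mul_of_nonneg_right h3 (norm_nonneg _))) h1
      _ = η ^ A.card * 4 ^ m * 2 * ‖Z U'‖ := by ring
      _ ≤ η ^ A.card * 4 ^ m * 2 * (2 * ‖Z (insert k U')‖) := by gcongr
      _ = _ := by ring

/-- Set functions with small iterated differences that are multiplicative over non-adjacent sets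
of a graph of bounded degree vary slowly. -/
theorem norm_insert_sub_le {Z : Finset X → ℂ} {adj : X → X → Prop}
    [DecidableRel adj] {Δ : ℕ} {η : ℝ} (hη : 0 ≤ η) (hη' : η * 4 ^ Δ ≤ 1 / 2)
    (hmul : ∀ A U, (∀ a ∈ A, ∀ b ∈ U, ¬ adj a b) → Z (A ∪ U) = Z A * Z U)
    (hdeg : ∀ (j : X) (U : Finset X), (U.filter (adj j)).card ≤ Δ)
    (hW : ∀ A, ‖altSum Z A ∅‖ ≤ η ^ A.card)
    (U : Finset X) (j : X) (hj : j ∉ U) :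
    ‖Z (insert j U) - Z U‖ ≤ 1 / 2 * ‖Z U‖ := by
  suffices ∀ n : ℕ, ∀ (U : Finset X) (j : X), U.card ≤ n → j ∉ U →
      ‖Z (insert j U) - Z U‖ ≤ 1 / 2 * ‖Z U‖ from this U.card U j le_rfl hj
  intro n
  induction n using Nat.strong_induction_on with
  | _ n ih =>
  intro U j hU hj
  -- For smaller sets the claim itself shows that inserting a point at most halves the norm, which
  -- is what the case A = {j} of the previous lemma requires.
  have hn : ∀ (U : Finset X) (k : X), U.card < n → k ∉ U → ‖Z U‖ ≤ 2 * ‖Z (insert k U)‖ := by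
    intro U k hUn hk
    have h1 := ih U.card hUn U k le_rfl hk
    have h2 := norm_sub_norm_le (Z U) (Z (insert k U))
    rw [norm_sub_rev] at h2
    linarith
  have h := norm_altSum_le_of_forall_erase hη (hη'.trans (by norm_num)) hmul hdeg hW n hn U hU {j}
    (by simpa using hj)
  rw [← insert_empty_eq, altSum_insert Z (Finset.notMem_empty j), altSum_empty, altSum_empty] at h
  refine h.trans ?_
  gcongr
  refine le_trans ?_ hη'
  simp only [insert_empty_eq, Finset.card_singleton, pow_one, Finset.mem_singleton,
    exists_eq_left]
  gcongr
  · norm_num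
  · exact hdeg j U

theorem ne_zero_of_norm_insert_sub_le {Z : Finset X → ℂ} (h0 : Z ∅ ≠ 0)
    (h : ∀ (U : Finset X) (j : X), j ∉ U → ‖Z (insert j U) - Z U‖ ≤ 1 / 2 * ‖Z U‖)
    (U : Finset X) : Z U ≠ 0 := by
  induction U using Finset.induction_on with
  | empty => exact h0
  | insert j U hj ih =>
    intro h1
    have h2 := h U j hj
    rw [h1, zero_sub, norm_neg] at h2
    have := norm_pos_iff.2 ih
    linarith

end ClusterExpansion

/-! ### Iterated differences of powers and exponentials of sums. -/

section PowerDifferences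

variable {X : Type u} [DecidableEq X]

/-- Splitting off the leftmost factor h j leaves the alternating sum over those B ⊆ A that contain
j; adding the difference over A \ {j} to that over A cancels all the other B. -/
theorem altSum_pow_succ {𝔸 : Type*} [Ring 𝔸] (h : X → 𝔸) (n : ℕ) (A : Finset X) :
    altSum (fun B => (∑ j ∈ B, h j) ^ (n + 1)) A ∅ =
      ∑ j ∈ A, h j * (altSum (fun B => (∑ j ∈ B, h j) ^ n) A ∅ +
        altSum (fun B => (∑ j ∈ B, h j) ^ n) (A.erase j) ∅) := by
  have key : ∀ j ∈ A, altSum (fun B => (∑ j ∈ B, h j) ^ n) A ∅ +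
        altSum (fun B => (∑ j ∈ B, h j) ^ n) (A.erase j) ∅ =
      ∑ B ∈ A.powerset, if j ∈ B then (-1 : ℤ) ^ (A \ B).card • (∑ j ∈ B, h j) ^ n else 0 := by
    intro j hj
    obtain ⟨A', hjA', rfl⟩ : ∃ A', j ∉ A' ∧ insert j A' = A :=
      ⟨A.erase j, Finset.notMem_erase _ _, Finset.insert_erase hj⟩
    rw [Finset.erase_insert hjA', altSum_insert _ hjA', sub_add_cancel,
      Finset.sum_powerset_insert hjA', Finset.sum_eq_zero, zero_add]
    · refine Finset.sum_congr rfl fun B hB => ?_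
      rw [if_pos (Finset.mem_insert_self _ _), Finset.insert_sdiff_insert,
        Finset.sdiff_insert_of_notMem hjA']
      simp [Finset.union_comm B]
    · intro B hB
      rw [if_neg fun h => hjA' (Finset.mem_powerset.1 hB h)]
  rw [Finset.sum_congr rfl fun j hj => by rw [key j hj, Finset.mul_sum], Finset.sum_comm]
  refine Finset.sum_congr rfl fun B hB => ?_
  rw [Finset.mem_powerset] at hB
  simp only [Finset.union_empty, mul_ite, mul_zero]
  rw [← Finset.sum_filter, Finset.filter_mem_eq_inter, Finset.inter_eq_right.2 hB, pow_succ',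
    Finset.sum_mul, Finset.smul_sum]
  simp only [mul_smul_comm]

theorem altSum_one_insert {M : Type*} [Ring M] {A : Finset X} {k : X} (hk : k ∉ A)
    (U : Finset X) : altSum (fun _ => (1 : M)) (insert k A) U = 0 := by
  rw [altSum_insert _ hk]
  simp [altSum]

/-- The recursion `altSum_pow_succ` has only positive signs, so the scalar model with every h j
equal to E majorizes the operators. -/
theorem norm_altSum_pow_le {𝔸 : Type*} [NormedRing 𝔸] [NormOneClass 𝔸] {h : X → 𝔸} {E : ℝ}
    (hE : 0 ≤ E) (h1 : ∀ j, ‖h j‖ ≤ E) (n : ℕ) (A : Finset X) :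
    ‖altSum (fun B => (∑ j ∈ B, h j) ^ n) A ∅‖ ≤
      E ^ n * altSum (fun B => (∑ _j ∈ B, (1 : ℝ)) ^ n) A ∅ := by
  induction n generalizing A with
  | zero =>
    simp only [pow_zero, one_mul]
    induction A using Finset.induction_on with
    | empty => simp [altSum_empty]
    | insert k A hk => simp [altSum_one_insert hk]
  | succ n ih =>
    rw [altSum_pow_succ, altSum_pow_succ, Finset.mul_sum]
    refine norm_sum_le_of_le _ fun j _ => ?_
    calc _ ≤ ‖h j‖ * (‖altSum (fun B => (∑ j ∈ B, h j) ^ n) A ∅‖ +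
          ‖altSum (fun B => (∑ j ∈ B, h j) ^ n) (A.erase j) ∅‖) :=
          (norm_mul_le _ _).trans (mul_le_mul_of_nonneg_left (norm_add_le _ _) (norm_nonneg _))
      _ ≤ E * (E ^ n * altSum (fun B => (∑ _j ∈ B, (1 : ℝ)) ^ n) A ∅ +
          E ^ n * altSum (fun B => (∑ _j ∈ B, (1 : ℝ)) ^ n) (A.erase j) ∅) := by
          gcongr
          exacts [h1 j, ih A, ih _]
      _ = _ := by ring

/-- The scalar model is multiplicative in the points, so each difference contributes one factor exp
E − 1. -/
theorem altSum_exp_mul_card (E : ℝ) (A : Finset X) :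
    altSum (fun B => Real.exp (E * B.card)) A ∅ = (Real.exp E - 1) ^ A.card := by
  suffices ∀ U, Disjoint A U → altSum (fun B => Real.exp (E * B.card)) A U =
      (Real.exp E - 1) ^ A.card * Real.exp (E * U.card) by simpa using this ∅ (by simp)
  induction A using Finset.induction_on with
  | empty => simp [altSum_empty]
  | insert k A hk ih =>
    intro U hU
    rw [Finset.disjoint_insert_left] at hU
    rw [altSum_insert _ hk, ih _ (by simp [hk, hU]), ih _ hU.2, Finset.card_insert_of_notMem hk,
      Finset.card_insert_of_notMem hU.1]
    push_cast
    rw [mul_add, Real.exp_add, mul_one]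
    ring

/-- The iterated differences of the exponentials of partial sums of a family of operators. -/
theorem norm_altSum_exp_le {𝔸 : Type*} [NormedRing 𝔸] [NormedAlgebra ℂ 𝔸] [CompleteSpace 𝔸]
    [NormOneClass 𝔸] {h : X → 𝔸} {E : ℝ} (hE : 0 ≤ E) (h1 : ∀ j, ‖h j‖ ≤ E) (A : Finset X) :
    ‖altSum (fun B => NormedSpace.exp (∑ j ∈ B, h j)) A ∅‖ ≤ (Real.exp E - 1) ^ A.card := by
  have hs : HasSum (fun n : ℕ => ((n.factorial : ℂ)⁻¹) • altSum (fun B => (∑ j ∈ B, h j) ^ n) A ∅)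
      (altSum (fun B => NormedSpace.exp (∑ j ∈ B, h j)) A ∅) := by
    unfold altSum
    simp only [Finset.smul_sum]
    refine hasSum_sum fun B _ => ?_
    have := (NormedSpace.exp_series_hasSum_exp' (𝕂 := ℂ) (∑ j ∈ B ∪ ∅, h j)).const_smul
      ((-1 : ℤ) ^ (A \ B).card)
    exact this.congr_fun fun n => smul_comm _ _ _
  have hr : HasSum (fun n : ℕ => ((n.factorial : ℝ)⁻¹) * (E ^ n *
      altSum (fun B => (∑ _j ∈ B, (1 : ℝ)) ^ n) A ∅)) ((Real.exp E - 1) ^ A.card) := by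
    rw [← altSum_exp_mul_card]
    unfold altSum
    simp only [Finset.mul_sum]
    refine hasSum_sum fun B _ => ?_
    have := (NormedSpace.exp_series_hasSum_exp' (𝕂 := ℝ) (E * ((B ∪ ∅).card : ℝ))).const_smul
      ((-1 : ℤ) ^ (A \ B).card)
    rw [← Real.exp_eq_exp_ℝ] at this
    refine (by simpa using this : HasSum _ _).congr_fun fun n => ?_
    simp only [Finset.union_empty, zsmul_eq_mul, Finset.sum_const, nsmul_eq_mul, mul_one, mul_pow]
    push_cast
    ring
  refine hs.norm_le_of_bounded hr fun n => ?_
  rw [norm_smul, norm_inv, Complex.norm_natCast]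
  exact mul_le_mul_of_nonneg_left (norm_altSum_pow_le hE h1 n A) (by positivity)

end PowerDifferences
-- Supports of operators and factorization in product states.
section ProductStates

variable {X : Type u} {κ : X → Type v}

open Kronecker

/-- Configurations as pairs of a configuration on `S` and one on the complement of `S`. -/
abbrev splitEquiv (κ : X → Type v) (S : Set X) [DecidablePred (· ∈ S)] :
    (∀ i, κ i) ≃ (∀ i : S, κ i) × (∀ i : {i // i ∉ S}, κ i) :=
  Equiv.piEquivPiSubtypeProd (· ∈ S) κ

open scoped MatrixOrder in
theorem exists_eq_conjTranspose_mul_self {n : Type*} [Fintype n] {A : Matrix n n ℂ}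
    (hA : A.PosSemidef) : ∃ C : Matrix n n ℂ, A = C.conjTranspose * C := by
  classical
  exact CStarAlgebra.nonneg_iff_eq_star_mul_self.1 (Matrix.nonneg_iff_posSemidef.2 hA)

theorem extendOperator_eq_submatrix (S : Set X) [DecidablePred (· ∈ S)]
    [DecidableEq (∀ i : {i // i ∉ S}, κ i)] (B : Operator (fun i : S => κ i)) :
    extendOperator (κ := κ) S B = (B ⊗ₖ (1 : Operator (fun i : {i // i ∉ S} => κ i))).submatrix
      (splitEquiv κ S) (splitEquiv κ S) := by
  ext x y
  simp only [extendOperator, splitEquiv, Equiv.piEquivPiSubtypeProd, Equiv.coe_fn_mk,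
    Matrix.submatrix_apply, Matrix.kroneckerMap_apply, Matrix.one_apply, mul_ite, mul_one, mul_zero]
  classical
  exact if_congr (by simp only [funext_iff, Subtype.forall]) rfl rfl

theorem SupportedOn.mono {S T : Set X} (hST : S ⊆ T) {A : Operator κ} (hA : SupportedOn S A) :
    SupportedOn T A := by
  classical
  obtain ⟨B, rfl⟩ := hA
  refine ⟨fun x y => if ∀ i : T, (i : X) ∉ S → x i = y i then
    B (fun i => x ⟨i, hST i.2⟩) (fun i => y ⟨i, hST i.2⟩) else 0, ?_⟩
  ext x y
  simp only [extendOperator]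
  by_cases h1 : ∀ i, i ∉ T → x i = y i
  · rw [if_pos h1]
    exact if_congr ⟨fun h i hi => h i hi, fun h i hi =>
      (Classical.em (i ∈ T)).elim (fun hiT => h ⟨i, hiT⟩ hi) (h1 i)⟩ rfl rfl
  · rw [if_neg h1, if_neg fun h => h1 fun i hi => h i fun h' => hi (hST h')]

/-- The splitting along S is kept, so that operators supported on S and on its complement become the
two factors of one Kronecker product. -/
theorem SupportedOn.compl_eq_submatrix {S : Set X} [DecidablePred (· ∈ S)]
    [DecidableEq (∀ i : S, κ i)] {A : Operator κ} (hA : SupportedOn Sᶜ A) :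
    ∃ C : Operator (fun i : {i // i ∉ S} => κ i),
      A = ((1 : Operator (fun i : S => κ i)) ⊗ₖ C).submatrix
        (splitEquiv κ S) (splitEquiv κ S) := by
  obtain ⟨C, rfl⟩ := hA
  refine ⟨C, ?_⟩
  ext x y
  simp only [extendOperator, splitEquiv, Equiv.piEquivPiSubtypeProd, Equiv.coe_fn_mk,
    Matrix.submatrix_apply, Matrix.kroneckerMap_apply, Matrix.one_apply, ite_mul, one_mul, zero_mul]
  classical
  exact if_congr (by simp only [funext_iff, Subtype.forall, Set.mem_compl_iff, not_not]) rfl rfl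

variable [Fintype X]

theorem productState_mul [DecidableEq X] [∀ i, Fintype (κ i)]
    (A B : ∀ i, Matrix (κ i) (κ i) ℂ) :
    productState A * productState B = productState fun i => A i * B i := by
  ext x y
  simp only [productState, Matrix.mul_apply, ← Finset.prod_mul_distrib, Finset.prod_univ_sum,
    Fintype.piFinset_univ]

theorem trace_productState [DecidableEq X] [∀ i, Fintype (κ i)]
    (A : ∀ i, Matrix (κ i) (κ i) ℂ) : (productState A).trace = ∏ i, (A i).trace := by
  simp only [productState, Matrix.trace, Matrix.diag_apply, Finset.prod_univ_sum,
    Fintype.piFinset_univ]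

theorem isState_productState [DecidableEq X] [∀ i, Fintype (κ i)]
    {ρ : ∀ i, Matrix (κ i) (κ i) ℂ} (hρ : ∀ i, IsState (ρ i)) : IsState (productState ρ) := by
  classical
  refine ⟨?_, by simp [trace_productState, (hρ _).2]⟩
  choose C hC using fun i => exists_eq_conjTranspose_mul_self (hρ i).1
  have : productState ρ = (productState C).conjTranspose * productState C := by
    have h1 : (productState C).conjTranspose = productState fun i => (C i).conjTranspose := by
      ext x y
      simp [productState, Matrix.conjTranspose_apply, star_prod]
    rw [h1, productState_mul]
    congr 1
    funext i
    exact hC i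
  rw [this]
  exact Matrix.posSemidef_conjTranspose_mul_self _

theorem productState_eq_submatrix (S : Set X) [DecidablePred (· ∈ S)]
    (ρ : ∀ i, Matrix (κ i) (κ i) ℂ) :
    productState ρ = (productState (fun i : S => ρ i) ⊗ₖ
      productState (fun i : {i // i ∉ S} => ρ i)).submatrix
        (splitEquiv κ S) (splitEquiv κ S) := by
  ext x y
  simp only [productState, splitEquiv, Equiv.piEquivPiSubtypeProd, Equiv.coe_fn_mk,
    Matrix.submatrix_apply, Matrix.kroneckerMap_apply]
  exact (Fintype.prod_subtype_mul_prod_subtype (· ∈ S) fun i => ρ i (x i) (y i)).symm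

variable [DecidableEq X] [∀ i, Fintype (κ i)]

/-- In a product state, observables on disjoint regions are uncorrelated. -/
theorem average_mul_of_supportedOn_compl
    {ρ : ∀ i, Matrix (κ i) (κ i) ℂ} (hρ : ∀ i, (ρ i).trace = 1) {S : Set X} {A C : Operator κ}
    (hA : SupportedOn S A) (hC : SupportedOn Sᶜ C) :
    average (productState ρ) (A * C) =
      average (productState ρ) A * average (productState ρ) C := by
  classical
  obtain ⟨A, rfl⟩ := hA
  obtain ⟨C, rfl⟩ := hC.compl_eq_submatrix
  have h1 : (productState (fun i : S => ρ i)).trace = 1 := by simp [trace_productState, hρ]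
  have h2 : (productState (fun i : {i // i ∉ S} => ρ i)).trace = 1 := by
    simp [trace_productState, hρ]
  have htr : ∀ (M : Matrix ((∀ i : S, κ i) × (∀ i : {i // i ∉ S}, κ i))
      ((∀ i : S, κ i) × (∀ i : {i // i ∉ S}, κ i)) ℂ),
      (M.submatrix (splitEquiv κ S) (splitEquiv κ S)).trace = M.trace := fun M => by
    simp only [Matrix.trace, Matrix.diag_apply, Matrix.submatrix_apply]
    exact Equiv.sum_comp (splitEquiv κ S) fun i => M i i
  simp only [average, extendOperator_eq_submatrix, productState_eq_submatrix S ρ,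
    Matrix.submatrix_mul_equiv, ← Matrix.mul_kronecker_mul, htr, Matrix.trace_kronecker,
    h1, h2, one_mul, mul_one]

theorem commute_of_supportedOn_compl {S : Set X} {A C : Operator κ}
    (hA : SupportedOn S A) (hC : SupportedOn Sᶜ C) : Commute A C := by
  classical
  obtain ⟨A, rfl⟩ := hA
  obtain ⟨C, rfl⟩ := hC.compl_eq_submatrix
  simp only [Commute, SemiconjBy, extendOperator_eq_submatrix, Matrix.submatrix_mul_equiv,
    ← Matrix.mul_kronecker_mul, Matrix.one_mul, Matrix.mul_one]

variable [∀ i, DecidableEq (κ i)]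

open Classical in
/-- The inclusion of the operators on the sites in `S`. -/
noncomputable def extendHom (κ : X → Type v) [∀ i, Fintype (κ i)] [∀ i, DecidableEq (κ i)]
    (S : Set X) :
    Operator (fun i : S => κ i) →ₐ[ℂ] Operator κ :=
  AlgHom.ofLinearMap
    { toFun := extendOperator S
      map_add' := fun A B => by
        simp only [extendOperator_eq_submatrix, Matrix.add_kronecker]; rfl
      map_smul' := fun c A => by
        simp only [extendOperator_eq_submatrix, Matrix.smul_kronecker]; rfl }
    (by
      simp only [LinearMap.coe_mk, AddHom.coe_mk, extendOperator_eq_submatrix,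
        Matrix.one_kronecker_one]
      exact Matrix.submatrix_one_equiv _)
    (fun A B => by
      simp only [LinearMap.coe_mk, AddHom.coe_mk, extendOperator_eq_submatrix,
        Matrix.submatrix_mul_equiv, ← Matrix.mul_kronecker_mul, Matrix.one_mul])

open Classical in
theorem supportedOn_iff_mem_range {S : Set X} {A : Operator κ} :
    SupportedOn S A ↔ A ∈ (extendHom κ S).range :=
  ⟨fun ⟨B, hB⟩ => ⟨B, hB.symm⟩, fun ⟨B, hB⟩ => ⟨B, hB.symm⟩⟩

/-- The inclusion of local operators is a continuous algebra homomorphism, hence commutes with the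
exponential series. -/
theorem SupportedOn.exp {S : Set X} {A : Operator κ} (hA : SupportedOn S A) :
    SupportedOn S (NormedSpace.exp A) := by
  classical
  let := NormedAlgebra.restrictScalars ℚ ℂ (Operator fun i : S => κ i)
  obtain ⟨B, rfl⟩ := supportedOn_iff_mem_range.1 hA
  refine supportedOn_iff_mem_range.2 ⟨NormedSpace.exp B, ?_⟩
  have hc : Continuous (extendHom κ S) :=
    (extendHom κ S).toLinearMap.continuous_of_finiteDimensional
  exact NormedSpace.map_exp (extendHom κ S) hc B

theorem SupportedOn.sum {S : Set X} {ι : Type*} {s : Finset ι} {h : ι → Operator κ}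
    (hh : ∀ j ∈ s, SupportedOn S (h j)) : SupportedOn S (∑ j ∈ s, h j) :=
  supportedOn_iff_mem_range.2 (Subalgebra.sum_mem _ fun j hj => supportedOn_iff_mem_range.1 (hh j hj))

theorem SupportedOn.smul {S : Set X} {A : Operator κ} (hA : SupportedOn S A) (c : ℂ) :
    SupportedOn S (c • A) :=
  supportedOn_iff_mem_range.2 (Subalgebra.smul_mem _ (supportedOn_iff_mem_range.1 hA) c)

theorem SupportedOn.sub_smul_one {S : Set X} {A : Operator κ} (hA : SupportedOn S A) (c : ℂ) :
    SupportedOn S (A - c • 1) :=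
  supportedOn_iff_mem_range.2 (Subalgebra.sub_mem _ (supportedOn_iff_mem_range.1 hA)
    (Subalgebra.smul_mem _ (Subalgebra.one_mem _) c))

theorem average_exp_add {ρ : ∀ i, Matrix (κ i) (κ i) ℂ} (hρ : ∀ i, (ρ i).trace = 1) {S : Set X}
    {A C : Operator κ} (hA : SupportedOn S A) (hC : SupportedOn Sᶜ C) :
    average (productState ρ) (NormedSpace.exp (A + C)) =
      average (productState ρ) (NormedSpace.exp A) *
        average (productState ρ) (NormedSpace.exp C) := by
  rw [Matrix.exp_add_of_commute _ _ (commute_of_supportedOn_compl hA hC),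
    average_mul_of_supportedOn_compl hρ hA.exp hC.exp]

end ProductStates

/-! ### Expectations as contractive linear functionals. -/

section States

variable {n : Type v} [Fintype n]

/-- Writing ρ = C* C makes the expectation a sum of ⟨c_k, M c_k⟩ with Σ ‖c_k‖² = tr ρ = 1. -/
theorem norm_average_le [DecidableEq n] {ρ : Matrix n n ℂ} (hρ : IsState ρ) (M : Matrix n n ℂ) :
    ‖average ρ M‖ ≤ ‖M‖ := by
  obtain ⟨C, hC⟩ := exists_eq_conjTranspose_mul_self hρ.1
  let c : n → EuclideanSpace ℂ n := fun k => WithLp.toLp 2 (fun i => star (C k i))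
  have h1 : average ρ M = ∑ k, inner ℂ (c k) (WithLp.toLp 2 (M.mulVec (c k))) := by
    rw [average, hC, ← mul_assoc, Matrix.trace_mul_comm, ← mul_assoc]
    simp only [Matrix.trace, Matrix.diag_apply, Matrix.mul_apply, Matrix.conjTranspose_apply,
      PiLp.inner_apply, c, Matrix.mulVec, dotProduct, RCLike.inner_apply, Finset.sum_mul, Complex.star_def,
      Complex.conj_conj]
    refine Finset.sum_congr rfl fun k _ => ?_
    rw [Finset.sum_comm]
    refine Finset.sum_congr rfl fun i _ => Finset.sum_congr rfl fun j _ => ?_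
    ring
  have h2 : ∑ k, ‖c k‖ ^ 2 = 1 := by
    have := hρ.2
    rw [hC, Matrix.trace_mul_comm] at this
    simp only [EuclideanSpace.norm_sq_eq, c]
    have h3 : ((∑ k, ∑ i, ‖C k i‖ ^ 2 : ℝ) : ℂ) = 1 := by
      rw [← this]
      simp only [Matrix.trace, Matrix.diag_apply, Matrix.mul_apply, Matrix.conjTranspose_apply,
        Complex.star_def, Complex.mul_conj']
      push_cast
      rfl
    simpa using (by exact_mod_cast h3 : (∑ k, ∑ i, ‖C k i‖ ^ 2 : ℝ) = 1)
  rw [h1]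
  calc _ ≤ ∑ k, ‖M‖ * ‖c k‖ ^ 2 := by
        refine norm_sum_le_of_le _ fun k _ => (norm_inner_le_norm _ _).trans ?_
        have := mul_le_mul_of_nonneg_left (Matrix.l2_opNorm_mulVec M (c k)) (norm_nonneg (c k))
        refine this.trans (le_of_eq ?_)
        ring
    _ = ‖M‖ := by rw [← Finset.mul_sum, h2, mul_one]

theorem nonempty_of_isState {ρ : Matrix n n ℂ} (hρ : IsState ρ) : Nonempty n := by
  by_contra h
  rw [not_nonempty_iff] at h
  simpa [Matrix.trace] using hρ.2

/-- The average as a linear functional. -/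
noncomputable def averageHom (ρ : Matrix n n ℂ) : Matrix n n ℂ →ₗ[ℂ] ℂ where
  toFun := average ρ
  map_add' A B := by simp [average, add_mul]
  map_smul' c A := by simp [average]

@[simp]
theorem averageHom_apply (ρ A : Matrix n n ℂ) : averageHom ρ A = average ρ A := rfl

end States

/-! ### Local terms satisfy the hypotheses of the cluster induction. -/

section LocalHamiltonians

variable {X : Type u} [Fintype X] [DecidableEq X] {κ : X → Type v} [∀ i, Fintype (κ i)]
  [∀ i, DecidableEq (κ i)]

theorem average_exp_insert_sub_le {d : X → X → ℕ} (hd : IsLatticeMetric d) {R Δ : ℕ}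
    (hdeg : ∀ j, (Finset.univ.filter fun i => d i j ≤ 2 * R).card ≤ Δ)
    {ρ : ∀ i, Matrix (κ i) (κ i) ℂ} (hρ : ∀ i, IsState (ρ i)) {h : X → Operator κ} {E : ℝ}
    (hE : 0 ≤ E) (hE' : (Real.exp E - 1) * 4 ^ Δ ≤ 1 / 2) (hloc : ∀ j, IsLocalAt d R j (h j))
    (hnorm : ∀ j, ‖h j‖ ≤ E) (U : Finset X) (j : X) (hj : j ∉ U) :
    ‖average (productState ρ) (NormedSpace.exp (∑ j ∈ insert j U, h j)) -
        average (productState ρ) (NormedSpace.exp (∑ j ∈ U, h j))‖ ≤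
      1 / 2 * ‖average (productState ρ) (NormedSpace.exp (∑ j ∈ U, h j))‖ := by
  have hst := isState_productState hρ
  have := nonempty_of_isState hst
  refine norm_insert_sub_le
    (Z := fun B => average (productState ρ) (NormedSpace.exp (∑ j ∈ B, h j)))
    (adj := fun a b => d b a ≤ 2 * R) (η := Real.exp E - 1) (by linarith [Real.add_one_le_exp E])
    hE' ?_ (fun j U => (Finset.card_le_card (Finset.filter_subset_filter _
      (Finset.subset_univ U))).trans (hdeg j)) (fun A => ?_) U j hj
  · intro A U hAU
    -- Adjacency is reflexive, so non-adjacent sets are disjoint.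
    have hdisj : Disjoint A U := by
      rw [Finset.disjoint_left]
      intro a ha hb
      exact hAU a ha a hb (by simp [(hd.eq_zero_iff a a).2 rfl])
    rw [Finset.sum_union hdisj]
    -- The region is the union of the R-balls about A; a site also within R of some b ∈ U would put
    -- b within 2R of A.
    refine average_exp_add (fun i => (hρ i).2) (S := {i | ∃ a ∈ A, d i a ≤ R})
      (SupportedOn.sum fun a ha => (hloc a).mono fun i hi => by exact ⟨a, ha, hi⟩)
      (SupportedOn.sum fun b hb => (hloc b).mono ?_)
    rintro i hi ⟨a, ha, hia⟩
    refine hAU a ha b hb ?_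
    have h1 := hd.triangle b i a
    rw [hd.symm b i] at h1
    simp only [Set.mem_ofPred_eq] at hi
    omega
  · have h1 := norm_altSum_exp_le hE hnorm A
    refine le_trans (le_of_eq_of_le ?_ (norm_average_le hst _)) h1
    congr 1
    rw [← averageHom_apply]
    simp only [altSum, map_sum, map_zsmul, averageHom_apply]

end LocalHamiltonians

/-! ### Smoothing of distribution functions with the Fejér kernel. -/

section Smoothing

open MeasureTheory Real

/-- The Fejér kernel, a probability density up to a constant factor. -/
noncomputable def fejer (v : ℝ) : ℝ := sinc (v / 2) ^ 2

theorem continuous_fejer : Continuous fejer := by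
  unfold fejer
  exact (continuous_sinc.comp (continuous_id.div_const 2)).pow 2

theorem fejer_nonneg (v : ℝ) : 0 ≤ fejer v := sq_nonneg _

/-- The Fourier transform of the kernel is a triangle of compact support; hence only frequencies in
(0, 1] enter the smoothing inequality. -/
theorem fejer_eq_integral (v : ℝ) : fejer v = ∫ t in (0 : ℝ)..1, 2 * (1 - t) * cos (t * v) := by
  rcases eq_or_ne v 0 with rfl | hv
  · have : ∀ t ∈ Set.uIcc (0 : ℝ) 1, HasDerivAt (fun t : ℝ => 2 * t - t ^ 2) (2 * (1 - t) * cos (t * 0)) t := by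
      intro t _
      refine (((hasDerivAt_id t).const_mul 2).sub (hasDerivAt_pow 2 t)).congr_deriv ?_
      simp only [mul_zero, cos_zero, mul_one]
      ring
    rw [intervalIntegral.integral_eq_sub_of_hasDerivAt this
      (Continuous.intervalIntegrable (by fun_prop) _ _)]
    simp [fejer]; norm_num
  · have : ∀ t ∈ Set.uIcc (0 : ℝ) 1, HasDerivAt
        (fun t : ℝ => 2 * (1 - t) * (sin (t * v) / v) - 2 * (cos (t * v) / v ^ 2))
        (2 * (1 - t) * cos (t * v)) t := by
      intro t _
      have h1 : HasDerivAt (fun t : ℝ => t * v) v t := by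
        simpa using (hasDerivAt_id t).mul_const v
      have h2 : HasDerivAt (fun t : ℝ => 2 * (1 - t)) (-2) t := by
        simpa using ((hasDerivAt_id t).const_sub 1).const_mul 2
      refine ((h2.mul (h1.sin.div_const v)).sub
        ((h1.cos.div_const (v ^ 2)).const_mul 2)).congr_deriv ?_
      field_simp
      ring
    rw [intervalIntegral.integral_eq_sub_of_hasDerivAt this
      (Continuous.intervalIntegrable (by fun_prop) _ _), fejer, sinc_of_ne_zero (by positivity)]
    have h3 : cos v = 1 - 2 * sin (v / 2) ^ 2 := by
      rw [← cos_sq_add_sin_sq (v / 2), show v = 2 * (v / 2) by ring, cos_two_mul']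
      ring_nf
    simp only [one_mul, sub_self, mul_zero, zero_mul, cos_zero, sin_zero, zero_div, h3]
    field_simp
    ring

theorem fejer_le (v : ℝ) : fejer v ≤ 5 * (1 + v ^ 2)⁻¹ := by
  rw [← div_eq_mul_inv, le_div_iff₀ (by positivity)]
  have h1 : fejer v ≤ 1 := by
    unfold fejer
    rw [sq_le_one_iff_abs_le_one]
    exact abs_sinc_le_one _
  have h2 : fejer v * v ^ 2 ≤ 4 := by
    rcases eq_or_ne v 0 with rfl | hv
    · simp
    · rw [fejer, sinc_of_ne_zero (by positivity)]
      have : (sin (v / 2) / (v / 2)) ^ 2 * v ^ 2 = 4 * sin (v / 2) ^ 2 := by field_simp; ring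
      rw [this]
      linarith [sin_sq_le_one (v / 2)]
  linarith

theorem integrable_fejer : Integrable fejer :=
  (integrable_inv_one_add_sq.const_mul 5).mono' continuous_fejer.aestronglyMeasurable
    (Filter.Eventually.of_forall fun v => by
      rw [norm_of_nonneg (fejer_nonneg v)]; exact fejer_le v)

theorem integral_fejer_pos : 0 < ∫ v, fejer v :=
  integral_pos_of_integrable_nonneg_nonzero (x := 0) continuous_fejer integrable_fejer
    fejer_nonneg (by simp [fejer])

/-- Two thirds of the mass near the origin is enough for the tail to be absorbed in the smoothing
inequality. -/
theorem exists_setIntegral_fejer_ge :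
    ∃ h : ℝ, 0 < h ∧ 2 / 3 * ∫ v, fejer v ≤ ∫ v in Set.Ioc (-h) h, fejer v := by
  have h1 : Filter.Tendsto (fun h : ℝ => ∫ v in (-h)..h, fejer v) Filter.atTop (nhds (∫ v, fejer v)) :=
    intervalIntegral_tendsto_integral integrable_fejer Filter.tendsto_neg_atTop_atBot
      Filter.tendsto_id
  have h2 : 2 / 3 * ∫ v, fejer v < ∫ v, fejer v := by linarith [integral_fejer_pos]
  obtain ⟨h, hh, hpos⟩ := ((h1.eventually (lt_mem_nhds h2)).and (Filter.eventually_gt_atTop 0)).exists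
  refine ⟨h, hpos, ?_⟩
  rw [← intervalIntegral.integral_of_le (by linarith)]
  exact hh.le

/-- The primitive of the Fejér kernel. -/
noncomputable def fejerPrimitive (w : ℝ) : ℝ := ∫ t in (0 : ℝ)..1, 2 * (1 - t) * (w * sinc (t * w))

theorem integral_cos_mul_eq (t w : ℝ) : ∫ v in (0 : ℝ)..w, cos (t * v) = w * sinc (t * w) := by
  rcases eq_or_ne t 0 with rfl | ht
  · simp
  · rw [intervalIntegral.integral_comp_mul_left _ ht, integral_cos]
    rcases eq_or_ne w 0 with rfl | hw
    · simp
    · rw [sinc_of_ne_zero (by positivity)]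
      simp
      field_simp

theorem integral_fejer_eq_fejerPrimitive (w : ℝ) : ∫ v in (0 : ℝ)..w, fejer v = fejerPrimitive w := by
  simp only [fejer_eq_integral, fejerPrimitive]
  rw [intervalIntegral_intervalIntegral_swap]
  · simp only [intervalIntegral.integral_const_mul, integral_cos_mul_eq]
  · exact ((by fun_prop : Continuous _).continuousOn.integrableOn_compact
      (isCompact_uIcc.prod isCompact_uIcc)).mono_set
      (Set.prod_mono Set.uIoc_subset_uIcc Set.uIoc_subset_uIcc)

theorem setIntegral_Iic_fejer (w : ℝ) :
    ∫ v in Set.Iic w, fejer v = fejerPrimitive w + ∫ v in Set.Iic 0, fejer v := by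
  rw [← integral_fejer_eq_fejerPrimitive, ← intervalIntegral.integral_Iic_sub_Iic
    integrable_fejer.integrableOn integrable_fejer.integrableOn]
  ring

/-- Averaging the distribution function of `μ` with the Fejér kernel. -/
theorem integral_fejer_mul_cdf (μ : Measure ℝ) [IsProbabilityMeasure μ] (y : ℝ) :
    ∫ u, fejer u * μ.real (Set.Iic (y - u)) = ∫ x, (∫ v in Set.Iic (y - x), fejer v) ∂μ := by
  have h1 : ∀ u, fejer u * μ.real (Set.Iic (y - u)) =
      ∫ x, (if u ≤ y - x then fejer u else 0) ∂μ := by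
    intro u
    have : (fun x => if u ≤ y - x then fejer u else 0) =
        (Set.Iic (y - u)).indicator fun _ => fejer u := by
      ext x
      simp only [Set.indicator, Set.mem_Iic, le_sub_comm]
    rw [this, integral_indicator measurableSet_Iic, setIntegral_const, smul_eq_mul, mul_comm]
  simp only [h1]
  rw [integral_integral_swap]
  · refine integral_congr_ae (Filter.Eventually.of_forall fun x => ?_)
    simp only
    rw [← integral_indicator measurableSet_Iic]
    rfl
  · have h2 : Integrable (fun p : ℝ × ℝ => fejer p.1) ((volume : Measure ℝ).prod μ) :=
      integrable_fejer.comp_fst μ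
    refine h2.mono ?_ (Filter.Eventually.of_forall fun p => ?_)
    · refine (Measurable.ite (measurableSet_le measurable_fst (measurable_const.sub measurable_snd))
        (continuous_fejer.measurable.comp measurable_fst) measurable_const).aestronglyMeasurable
    · simp only [Function.uncurry]
      split_ifs <;> simp

theorem mul_sinc_eq {t : ℝ} (ht : t ≠ 0) (w : ℝ) : w * sinc (t * w) = sin (t * w) / t := by
  rcases eq_or_ne w 0 with rfl | hw
  · simp
  · rw [sinc_of_ne_zero (by positivity)]
    field_simp

/-- The integrand is sin(t(y − x))/t, the imaginary part of an exponential; this is where the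
characteristic function appears. -/
theorem integral_mul_sinc (μ : Measure ℝ) [IsProbabilityMeasure μ] {t : ℝ} (ht : t ≠ 0) (y : ℝ) :
    ∫ x, (y - x) * sinc (t * (y - x)) ∂μ =
      -(Complex.exp (-(t * y) * Complex.I) * charFun μ t).im / t := by
  have h1 : Complex.exp (-(t * y) * Complex.I) * charFun μ t =
      ∫ x : ℝ, Complex.exp (((t * (x - y) : ℝ) : ℂ) * Complex.I) ∂μ := by
    rw [charFun_apply_real, ← integral_const_mul]
    refine integral_congr_ae (Filter.Eventually.of_forall fun x => ?_)
    simp only [← Complex.exp_add]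
    congr 1
    push_cast
    ring
  have hint : Integrable (fun x : ℝ => Complex.exp (((t * (x - y) : ℝ) : ℂ) * Complex.I)) μ := by
    refine (integrable_const (1 : ℝ)).mono' (Continuous.aestronglyMeasurable (by fun_prop))
      (Filter.Eventually.of_forall fun x => ?_)
    rw [Complex.norm_exp_ofReal_mul_I]
  have h2 : (Complex.exp (-(t * y) * Complex.I) * charFun μ t).im = ∫ x, sin (t * (x - y)) ∂μ := by
    rw [h1, ← Complex.imCLM_apply, ← Complex.imCLM.integral_comp_comm hint]
    simp only [Complex.imCLM_apply, Complex.exp_ofReal_mul_I_im]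
  rw [h2, neg_div, ← integral_div, ← integral_neg]
  refine integral_congr_ae (Filter.Eventually.of_forall fun x => ?_)
  simp only [mul_sinc_eq ht]
  rw [← neg_div, ← sin_neg]
  ring_nf

theorem continuous_sinc_mul {α : Type*} [TopologicalSpace α] {f : α → ℝ} (hf : Continuous f) :
    Continuous fun x => sinc (f x) := continuous_sinc.comp hf

theorem norm_mul_mul_sinc_le {t : ℝ} (ht : t ∈ Set.Icc (0 : ℝ) 1) (w : ℝ) :
    ‖2 * (1 - t) * (w * sinc (t * w))‖ ≤ 2 * |w| := by
  rw [norm_mul, norm_mul, norm_mul, norm_of_nonneg (by linarith [ht.2] : 0 ≤ 1 - t), norm_two,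
    norm_eq_abs, norm_eq_abs]
  have h1 := abs_sinc_le_one (t * w)
  have h2 := abs_nonneg w
  have h3 : |w| * |sinc (t * w)| ≤ |w| := mul_le_of_le_one_right h2 h1
  have h4 : (1 - t) * (|w| * |sinc (t * w)|) ≤ 1 * |w| :=
    mul_le_mul (by linarith [ht.1]) h3 (by positivity) zero_le_one
  linarith

/-- The first moment of μ supplies the majorant 2|y − x| needed for Fubini. -/
theorem integrable_prod_mul_sinc (μ : Measure ℝ) [IsProbabilityMeasure μ]
    (hμ : Integrable id μ) (y : ℝ) :
    Integrable (Function.uncurry fun (t x : ℝ) => 2 * (1 - t) * ((y - x) * sinc (t * (y - x))))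
      (((volume : Measure ℝ).restrict (Set.uIoc 0 1)).prod μ) := by
  have hfin : IsFiniteMeasure ((volume : Measure ℝ).restrict (Set.uIoc 0 1)) := ⟨by simp⟩
  have h1 : Integrable (fun p : ℝ × ℝ => 2 * |y - p.2|)
      (((volume : Measure ℝ).restrict (Set.uIoc 0 1)).prod μ) :=
    ((((integrable_const y).sub hμ).abs).const_mul 2).comp_snd _
  refine h1.mono' (Continuous.aestronglyMeasurable ?_) ?_
  · unfold Function.uncurry
    exact (by fun_prop : Continuous fun p : ℝ × ℝ => 2 * (1 - p.1)).mul
      ((by fun_prop : Continuous fun p : ℝ × ℝ => y - p.2).mul (continuous_sinc_mul (by fun_prop)))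
  · filter_upwards [Measure.quasiMeasurePreserving_fst.ae
      (ae_restrict_mem (μ := volume) (measurableSet_uIoc (a := (0 : ℝ)) (b := 1)))] with p hp
    rw [Set.uIoc_of_le zero_le_one] at hp
    exact norm_mul_mul_sinc_le ⟨hp.1.le, hp.2⟩ _

theorem integral_fejerPrimitive_sub (μ : Measure ℝ) [IsProbabilityMeasure μ]
    (hμ : Integrable id μ) (y : ℝ) :
    ∫ x, fejerPrimitive (y - x) ∂μ =
      ∫ t in (0 : ℝ)..1, 2 * (1 - t) * ∫ x, (y - x) * sinc (t * (y - x)) ∂μ := by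
  simp only [fejerPrimitive, ← integral_const_mul]
  rw [intervalIntegral_integral_swap (integrable_prod_mul_sinc μ hμ y)]

theorem continuous_fejerPrimitive : Continuous fejerPrimitive :=
  intervalIntegral.continuous_parametric_intervalIntegral_of_continuous'
    (f := fun w t => 2 * (1 - t) * (w * sinc (t * w)))
    ((by fun_prop : Continuous fun p : ℝ × ℝ => 2 * (1 - p.2)).mul
      (continuous_fst.mul (continuous_sinc_mul (by fun_prop)))) 0 1

theorem integrable_fejerPrimitive_sub (μ : Measure ℝ) [IsProbabilityMeasure μ]
    (hμ : Integrable id μ) (y : ℝ) : Integrable (fun x => fejerPrimitive (y - x)) μ := by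
  refine ((((integrable_const y).sub hμ).abs).const_mul 2).mono'
    (continuous_fejerPrimitive.comp (by fun_prop)).aestronglyMeasurable
    (Filter.Eventually.of_forall fun x => ?_)
  have := intervalIntegral.norm_integral_le_of_norm_le_const (a := 0) (b := 1)
    (f := fun t => 2 * (1 - t) * ((y - x) * sinc (t * (y - x)))) (C := 2 * |y - x|) fun t ht => by
      rw [Set.uIoc_of_le zero_le_one] at ht
      exact norm_mul_mul_sinc_le ⟨ht.1.le, ht.2⟩ _
  simpa [fejerPrimitive] using this

/-- The last summand does not depend on μ, so it cancels in the difference of two measures. -/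
theorem integral_setIntegral_Iic_fejer (μ : Measure ℝ) [IsProbabilityMeasure μ]
    (hμ : Integrable id μ) (y : ℝ) :
    ∫ x, (∫ v in Set.Iic (y - x), fejer v) ∂μ =
      (∫ t in (0 : ℝ)..1, 2 * (1 - t) * ∫ x, (y - x) * sinc (t * (y - x)) ∂μ) +
        ∫ v in Set.Iic 0, fejer v := by
  have h1 : ∀ x, _ := fun x => setIntegral_Iic_fejer (y - x)
  simp only [h1]
  rw [integral_add (integrable_fejerPrimitive_sub μ hμ y) (integrable_const _),
    integral_fejerPrimitive_sub μ hμ y]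
  simp

theorem intervalIntegrable_mul_integral_mul_sinc (μ : Measure ℝ) [IsProbabilityMeasure μ]
    (hμ : Integrable id μ) (y : ℝ) :
    IntervalIntegrable (fun t => 2 * (1 - t) * ∫ x, (y - x) * sinc (t * (y - x)) ∂μ) volume 0 1 := by
  have := (integrable_prod_mul_sinc μ hμ y).integral_prod_left
  simp only [Function.uncurry, integral_const_mul] at this
  rwa [intervalIntegrable_iff]

theorem integrable_fejer_mul_cdf (μ : Measure ℝ) [IsProbabilityMeasure μ] (y : ℝ) :
    Integrable fun u => fejer u * μ.real (Set.Iic (y - u)) := by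
  refine integrable_fejer.mul_bdd (c := 1) ?_ ?_
  · refine Measurable.aestronglyMeasurable (Antitone.measurable fun a b hab => ?_)
    exact measureReal_mono (Set.Iic_subset_Iic.2 (by linarith))
  · refine Filter.Eventually.of_forall fun x => ?_
    rw [norm_of_nonneg measureReal_nonneg]
    exact measureReal_le_one

/-- The smoothed difference of two distribution functions is controlled by the difference of the
characteristic functions. -/
theorem abs_integral_fejer_mul_sub_le {μ ν : Measure ℝ} [IsProbabilityMeasure μ]
    [IsProbabilityMeasure ν] (hμ : Integrable id μ) (hν : Integrable id ν) {B : ℝ → ℝ}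
    (hB : IntervalIntegrable B volume 0 1)
    (h : ∀ t ∈ Set.Ioc (0 : ℝ) 1, ‖charFun μ t - charFun ν t‖ ≤ t * B t) (y : ℝ) :
    |∫ u, fejer u * (μ.real (Set.Iic (y - u)) - ν.real (Set.Iic (y - u)))| ≤
      2 * ∫ t in (0 : ℝ)..1, B t := by
  have h1 : ∫ u, fejer u * (μ.real (Set.Iic (y - u)) - ν.real (Set.Iic (y - u))) =
      ∫ t in (0 : ℝ)..1, (2 * (1 - t) * ∫ x, (y - x) * sinc (t * (y - x)) ∂μ -
        2 * (1 - t) * ∫ x, (y - x) * sinc (t * (y - x)) ∂ν) := by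
    have h2 : ∀ u, fejer u * (μ.real (Set.Iic (y - u)) - ν.real (Set.Iic (y - u))) =
        fejer u * μ.real (Set.Iic (y - u)) - fejer u * ν.real (Set.Iic (y - u)) :=
      fun u => mul_sub _ _ _
    simp only [h2]
    rw [integral_sub (integrable_fejer_mul_cdf μ y) (integrable_fejer_mul_cdf ν y),
      integral_fejer_mul_cdf, integral_fejer_mul_cdf, integral_setIntegral_Iic_fejer μ hμ,
      integral_setIntegral_Iic_fejer ν hν, add_sub_add_right_eq_sub,
      ← intervalIntegral.integral_sub (intervalIntegrable_mul_integral_mul_sinc μ hμ y)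
        (intervalIntegrable_mul_integral_mul_sinc ν hν y)]
  rw [h1, ← norm_eq_abs, ← intervalIntegral.integral_const_mul]
  refine intervalIntegral.norm_integral_le_of_norm_le zero_le_one
    (Filter.Eventually.of_forall fun t ht => ?_) (hB.const_mul 2)
  rw [integral_mul_sinc μ ht.1.ne', integral_mul_sinc ν ht.1.ne', ← mul_sub, ← sub_div, norm_mul,
    norm_mul, norm_two, norm_div, norm_of_nonneg (by linarith [ht.2] : 0 ≤ 1 - t),
    norm_of_nonneg ht.1.le]
  have h2 : ‖-(Complex.exp (-(t * y) * Complex.I) * charFun μ t).im -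
      -(Complex.exp (-(t * y) * Complex.I) * charFun ν t).im‖ ≤ t * B t := by
    rw [← norm_neg, neg_sub, neg_sub_neg, ← Complex.sub_im, ← mul_sub]
    refine (Complex.abs_im_le_norm _).trans ?_
    rw [norm_mul]
    have : ‖Complex.exp (-(t * y) * Complex.I)‖ = 1 := by
      have := Complex.norm_exp_ofReal_mul_I (-(t * y))
      push_cast at this
      exact this
    rw [this, one_mul]
    exact h t ht
  have h3 := (div_le_iff₀' ht.1).2 h2
  have h4 : 0 ≤ B t := le_trans (by positivity [ht.1.le]) h3
  calc _ ≤ 2 * (1 - t) * B t := by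
        have : 0 ≤ 1 - t := by linarith [ht.2]
        gcongr
    _ ≤ 2 * B t := by nlinarith [ht.1]

/-- The smoothing inequality: a bound for an averaged difference of distribution functions bounds
the difference itself. -/
theorem exists_abs_sub_le_of_abs_integral_fejer_le :
    ∃ C : ℝ, 0 < C ∧ ∀ (F G : ℝ → ℝ) (m δ : ℝ), 0 ≤ m → Monotone F →
      (∀ y, Integrable fun u => fejer u * (F (y - u) - G (y - u))) →
      (∀ y, |F y - G y| ≤ 1) → (∀ a b, a ≤ b → G b - G a ≤ m * (b - a)) →
      (∀ y, |∫ u, fejer u * (F (y - u) - G (y - u))| ≤ δ) →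
      ∀ y, |F y - G y| ≤ C * (m + δ) := by
  obtain ⟨h, hh, hc⟩ := exists_setIntegral_fejer_ge
  set c := ∫ v, fejer v with hcdef
  have hcpos : 0 < c := integral_fejer_pos
  set c' := ∫ v in Set.Ioc (-h) h, fejer v with hc'def
  have hc'pos : 0 < c' := by linarith
  -- Twice the coefficients 2h and 3/(2c) in `hstep`, whose term η/2 is absorbed on the left.
  refine ⟨4 * h + 3 / c, by positivity, fun F G m δ hm0 hF hint h1 hG hδ => ?_⟩
  set η := ⨆ y, |F y - G y| with hη
  have hbdd : BddAbove (Set.range fun y => |F y - G y|) := ⟨1, by rintro _ ⟨y, rfl⟩; exact h1 y⟩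
  have hle : ∀ y, |F y - G y| ≤ η := fun y => le_ciSup hbdd y
  have hη0 : 0 ≤ η := (abs_nonneg _).trans (hle 0)
  have hδ0 : 0 ≤ δ := (abs_nonneg _).trans (hδ 0)
  have htail : ∫ v in (Set.Ioc (-h) h)ᶜ, fejer v = c - c' := by
    rw [hcdef, ← integral_add_compl measurableSet_Ioc integrable_fejer]
    ring
  have key : ∀ (ε : ℝ) (y D : ℝ), |ε| = 1 →
      (∀ u ∈ Set.Ioc (-h) h, D ≤ ε * (F (y - u) - G (y - u))) → c' * D ≤ δ + η * (c - c') := by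
    intro ε y D hε hD
    have h2 := integral_add_compl (measurableSet_Ioc (a := -h) (b := h)) ((hint y).const_mul ε)
    have h3 : c' * D ≤ ∫ u in Set.Ioc (-h) h, ε * (fejer u * (F (y - u) - G (y - u))) := by
      rw [hc'def, ← integral_mul_const]
      refine setIntegral_mono_on (integrable_fejer.mul_const D).integrableOn
        ((hint y).const_mul ε).integrableOn measurableSet_Ioc fun u hu => ?_
      have := mul_le_mul_of_nonneg_left (hD u hu) (fejer_nonneg u)
      linarith
    have h4 : -(η * (c - c')) ≤
        ∫ u in (Set.Ioc (-h) h)ᶜ, ε * (fejer u * (F (y - u) - G (y - u))) := by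
      rw [← htail, ← integral_const_mul, ← integral_neg]
      refine setIntegral_mono (integrable_fejer.const_mul η).neg.integrableOn
        ((hint y).const_mul ε).integrableOn fun u => ?_
      have h5 : |ε * (F (y - u) - G (y - u))| ≤ η := by rw [abs_mul, hε, one_mul]; exact hle _
      have h6 := mul_le_mul_of_nonneg_left (neg_le_of_abs_le h5) (fejer_nonneg u)
      show -(η * fejer u) ≤ ε * (fejer u * (F (y - u) - G (y - u)))
      linarith
    have h5 : ∫ u, ε * (fejer u * (F (y - u) - G (y - u))) ≤ δ := by
      rw [integral_const_mul]
      refine (le_abs_self _).trans ?_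
      rw [abs_mul, hε, one_mul]
      exact hδ y
    linarith
  -- The window is centred at y + h or y − h according to the sign of F − G at y. Monotonicity of F
  -- and the slope bound on G then keep that sign's excess throughout the window, up to a loss 2mh.
  have hstep : ∀ y, |F y - G y| ≤ 2 * m * h + 3 / (2 * c) * δ + η / 2 := by
    intro y
    have h2 : c' * (|F y - G y| - 2 * m * h) ≤ δ + η * (c - c') := by
      rcases le_total 0 (F y - G y) with h0 | h0
      · rw [abs_of_nonneg h0]
        refine key 1 (y + h) _ (by simp) fun u hu => ?_
        have h3 := hF (show y ≤ y + h - u by linarith [hu.2])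
        have h4 := hG y (y + h - u) (by linarith [hu.2])
        have h5 : m * (y + h - u - y) ≤ 2 * m * h := by nlinarith [hu.1, hu.2]
        linarith
      · rw [abs_of_nonpos h0]
        refine key (-1) (y - h) _ (by simp) fun u hu => ?_
        have h3 := hF (show y - h - u ≤ y by linarith [hu.1])
        have h4 := hG (y - h - u) y (by linarith [hu.1])
        have h5 : m * (y - (y - h - u)) ≤ 2 * m * h := by nlinarith [hu.1, hu.2]
        linarith
    -- From c' ≥ 2c/3 the tail mass satisfies c − c' ≤ c'/2.
    have h3 : η * (c - c') ≤ c' * (η / 2) := by nlinarith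
    have h4 : δ ≤ c' * (3 / (2 * c) * δ) := by
      have : 1 ≤ c' * (3 / (2 * c)) := by
        rw [mul_div_assoc', le_div_iff₀ (by positivity)]; linarith
      nlinarith
    have h5 : c' * |F y - G y| ≤ c' * (2 * m * h + 3 / (2 * c) * δ + η / 2) := by linarith
    exact le_of_mul_le_mul_left h5 hc'pos
  have h2 : η ≤ 2 * m * h + 3 / (2 * c) * δ + η / 2 := ciSup_le hstep
  intro y
  refine (hle y).trans ?_
  have h3 : 3 / (2 * c) * δ = 3 / c * δ / 2 := by field_simp
  have h5 : 0 ≤ 3 / c * m := by positivity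
  have h6 : 0 ≤ h * δ := by positivity
  nlinarith

end Smoothing
-- Esseen's inequality and the Berry–Esseen bound from an analytic logarithm.
section BerryEsseen

open MeasureTheory

theorem exists_abs_cdf_sub_le :
    ∃ C : ℝ, 0 < C ∧ ∀ (μ ν : Measure ℝ) [IsProbabilityMeasure μ] [IsProbabilityMeasure ν]
      (m : ℝ) (B : ℝ → ℝ), 0 ≤ m → Integrable id μ → Integrable id ν →
      (∀ a b, a ≤ b → ν.real (Set.Iic b) - ν.real (Set.Iic a) ≤ m * (b - a)) →
      IntervalIntegrable B volume 0 1 →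
      (∀ t ∈ Set.Ioc (0 : ℝ) 1, ‖charFun μ t - charFun ν t‖ ≤ t * B t) →
      ∀ y, |μ.real (Set.Iic y) - ν.real (Set.Iic y)| ≤ C * (m + ∫ t in (0 : ℝ)..1, B t) := by
  obtain ⟨C, hC, h⟩ := exists_abs_sub_le_of_abs_integral_fejer_le
  refine ⟨2 * C, by positivity, fun μ ν _ _ m B hm hμ hν hlip hB hchar y => ?_⟩
  have h1 := h (fun y => μ.real (Set.Iic y)) (fun y => ν.real (Set.Iic y)) m _ hm
    (fun a b hab => measureReal_mono (Set.Iic_subset_Iic.2 hab))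
    (fun y => ((integrable_fejer_mul_cdf μ y).sub (integrable_fejer_mul_cdf ν y)).congr
      (Filter.Eventually.of_forall fun u => (mul_sub _ _ _).symm))
    (fun y => abs_sub_le_iff.2 ⟨?_, ?_⟩) hlip
    (abs_integral_fejer_mul_sub_le hμ hν hB hchar) y
  · refine h1.trans ?_
    nlinarith
  · linarith [measureReal_nonneg (μ := ν) (s := Set.Iic y), measureReal_le_one (μ := μ) (s := Set.Iic y)]
  · linarith [measureReal_nonneg (μ := μ) (s := Set.Iic y), measureReal_le_one (μ := ν) (s := Set.Iic y)]

/-- Esseen's inequality with an unspecified constant. -/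
theorem exists_abs_cdf_sub_le_of_charFun :
    ∃ C : ℝ, 0 < C ∧ ∀ (μ ν : Measure ℝ) [IsProbabilityMeasure μ] [IsProbabilityMeasure ν]
      (m T : ℝ) (B : ℝ → ℝ), 0 ≤ m → 0 < T → Integrable id μ → Integrable id ν →
      (∀ a b, a ≤ b → ν.real (Set.Iic b) - ν.real (Set.Iic a) ≤ m * (b - a)) →
      Continuous B →
      (∀ t ∈ Set.Ioc (0 : ℝ) T, ‖charFun μ t - charFun ν t‖ ≤ t * B t) →
      ∀ y, |μ.real (Set.Iic y) - ν.real (Set.Iic y)| ≤ C * (m / T + ∫ t in (0 : ℝ)..T, B t) := by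
  obtain ⟨C, hC, h⟩ := exists_abs_cdf_sub_le
  refine ⟨C, hC, fun μ ν _ _ m T B hm hT hμ hν hlip hB hchar y => ?_⟩
  have hmeas : Measurable fun x : ℝ => T * x := measurable_const_mul T
  have hμ' : IsProbabilityMeasure (μ.map fun x => T * x) := Measure.isProbabilityMeasure_map hmeas.aemeasurable
  have hν' : IsProbabilityMeasure (ν.map fun x => T * x) := Measure.isProbabilityMeasure_map hmeas.aemeasurable
  have hcdf : ∀ (μ : Measure ℝ) (y : ℝ), (μ.map fun x => T * x).real (Set.Iic y) = μ.real (Set.Iic (y / T)) := by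
    intro μ y
    rw [map_measureReal_apply hmeas measurableSet_Iic]
    congr 1
    ext x
    simp [le_div_iff₀' hT]
  have hint : ∀ μ : Measure ℝ, Integrable id μ → Integrable id (μ.map fun x => T * x) := by
    intro μ hμ
    rw [integrable_map_measure aestronglyMeasurable_id hmeas.aemeasurable]
    exact hμ.const_mul T
  -- Dilation by T moves the frequency cutoff from T to 1 and divides the slope bound by T.
  have h1 := h (μ.map fun x => T * x) (ν.map fun x => T * x) (m / T) (fun t => T * B (T * t))
    (by positivity) (hint μ hμ) (hint ν hν) (fun a b hab => ?_)
    (Continuous.intervalIntegrable (by fun_prop) _ _) (fun t ht => ?_) (T * y)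
  · rw [hcdf, hcdf, mul_div_cancel_left₀ _ hT.ne', intervalIntegral.integral_const_mul,
      intervalIntegral.mul_integral_comp_mul_left, mul_zero, mul_one] at h1
    exact h1
  · rw [hcdf, hcdf]
    refine (hlip _ _ (by gcongr)).trans (le_of_eq ?_)
    field_simp
  · rw [charFun_map_mul, charFun_map_mul]
    refine (hchar (T * t) ⟨mul_pos hT ht.1, by nlinarith [ht.2]⟩).trans (le_of_eq ?_)
    ring

theorem gaussianCumulative_eq (y : ℝ) :
    gaussianCumulative y = (ProbabilityTheory.gaussianReal 0 1).real (Set.Iic y) := by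
  rw [Measure.real, ProbabilityTheory.gaussianReal_apply_eq_integral 0 one_ne_zero,
    ENNReal.toReal_ofReal (integral_nonneg fun x => ProbabilityTheory.gaussianPDFReal_nonneg _ _ _),
    gaussianCumulative, ← integral_const_mul]
  simp [ProbabilityTheory.gaussianPDFReal]

theorem gaussianReal_Iic_sub_le (a b : ℝ) (hab : a ≤ b) :
    (ProbabilityTheory.gaussianReal 0 1).real (Set.Iic b) -
      (ProbabilityTheory.gaussianReal 0 1).real (Set.Iic a) ≤ 1 * (b - a) := by
  have h1 : (ProbabilityTheory.gaussianReal 0 1).real (Set.Iic b) -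
      (ProbabilityTheory.gaussianReal 0 1).real (Set.Iic a) =
      (ProbabilityTheory.gaussianReal 0 1).real (Set.Ioc a b) := by
    rw [show Set.Ioc a b = Set.Iic b \ Set.Iic a by ext; simp [and_comm], measureReal_sdiff (Set.Iic_subset_Iic.2 hab) measurableSet_Iic]
  rw [h1, Measure.real, ProbabilityTheory.gaussianReal_apply_eq_integral 0 one_ne_zero,
    ENNReal.toReal_ofReal (integral_nonneg fun x => ProbabilityTheory.gaussianPDFReal_nonneg _ _ _)]
  have h2 : 1 * (volume : Measure ℝ).real (Set.Ioc a b) = 1 * (b - a) := by simp [hab]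
  rw [← h2]
  refine (Real.le_norm_self _).trans (norm_setIntegral_le_of_norm_le_const measure_Ioc_lt_top
    fun x _ => ?_)
  rw [Real.norm_of_nonneg (ProbabilityTheory.gaussianPDFReal_nonneg _ _ _),
    ProbabilityTheory.gaussianPDFReal]
  refine mul_le_one₀ ?_ (Real.exp_pos _).le ?_
  · refine inv_le_one_of_one_le₀ (Real.one_le_sqrt.2 ?_)
    simp
    linarith [Real.pi_gt_three]
  · rw [Real.exp_le_one_iff]
    exact div_nonpos_of_nonpos_of_nonneg (by simpa using sq_nonneg x) (by simp)

section FiniteMeasure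

variable {ι : Type*} [Fintype ι]

/-- The measure with mass `p k` at `e k`. -/
noncomputable def finiteMeasure (p e : ι → ℝ) : Measure ℝ :=
  ∑ k, ENNReal.ofReal (p k) • Measure.dirac (e k)

variable {p : ι → ℝ} (e : ι → ℝ)

theorem integral_finiteMeasure {E : Type*} [NormedAddCommGroup E] [NormedSpace ℝ E]
    [CompleteSpace E] (hp : ∀ k, 0 ≤ p k) (f : ℝ → E) :
    ∫ x, f x ∂finiteMeasure p e = ∑ k, p k • f (e k) := by
  rw [finiteMeasure, integral_finsetSum_measure]
  · simp [integral_smul_measure, hp]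
  · exact fun k _ => (integrable_dirac (by simp)).smul_measure (by simp)

theorem integrable_finiteMeasure {E : Type*} [NormedAddCommGroup E]  (f : ℝ → E) :
    Integrable f (finiteMeasure p e) := by
  rw [finiteMeasure, integrable_finsetSum_measure]
  exact fun k _ => (integrable_dirac (by simp)).smul_measure (by simp)

theorem isProbabilityMeasure_finiteMeasure (hp : ∀ k, 0 ≤ p k) (hp1 : ∑ k, p k = 1) :
    IsProbabilityMeasure (finiteMeasure p e) := by
  constructor
  simp only [finiteMeasure, Measure.finsetSum_apply, Measure.smul_apply, measure_univ, smul_eq_mul, mul_one]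
  rw [← ENNReal.ofReal_sum_of_nonneg fun k _ => hp k, hp1, ENNReal.ofReal_one]

theorem finiteMeasure_real_Iic (hp : ∀ k, 0 ≤ p k) (y : ℝ) :
    (finiteMeasure p e).real (Set.Iic y) = ∑ k with e k ≤ y, p k := by
  have h1 := integral_finiteMeasure e hp ((Set.Iic y).indicator fun _ => (1 : ℝ))
  rw [integral_indicator measurableSet_Iic] at h1
  simp only [setIntegral_const, smul_eq_mul, mul_one] at h1
  rw [h1, Finset.sum_filter]
  simp [Set.indicator]

theorem charFun_finiteMeasure (hp : ∀ k, 0 ≤ p k) (t : ℝ) :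
    charFun (finiteMeasure p e) t = ∑ k, (p k : ℂ) * Complex.exp (t * Complex.I * e k) := by
  rw [charFun_apply_real, integral_finiteMeasure e hp]
  refine Finset.sum_congr rfl fun k _ => ?_
  rw [Complex.real_smul]
  ring_nf

end FiniteMeasure

/-- The Taylor expansion of a bounded logarithm of a moment generating function. -/
theorem norm_log_mgf_sub_le {ι : Type*} [Fintype ι] {p e : ι → ℝ} (hp1 : ∑ k, p k = 1)
    (he1 : ∑ k, p k * e k = 0) (he2 : ∑ k, p k * e k ^ 2 = 1) {L : ℂ → ℂ} {r M : ℝ}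
    (hr : 0 < r) (hL : DifferentiableOn ℂ L (Metric.ball 0 r)) (hL0 : L 0 = 0)
    (hM : ∀ w ∈ Metric.ball (0 : ℂ) r, ‖L w‖ ≤ M)
    (hexp : ∀ w ∈ Metric.ball (0 : ℂ) r, Complex.exp (L w) = ∑ k, (p k : ℂ) * Complex.exp (w * e k))
    {w : ℂ} (hw : w ∈ Metric.ball (0 : ℂ) r) :
    ‖L w - w ^ 2 / 2‖ ≤ (M + r ^ 2 / 2) * (‖w‖ / r) ^ 3 := by
  have hφ : (fun w : ℂ => (∑ k, (p k : ℂ) * Complex.exp (w * e k)) - 1 - w ^ 2 / 2)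
      =o[nhds 0] fun w => w ^ 2 := by
    have h1 : ∀ w : ℂ, (∑ k, (p k : ℂ) * Complex.exp (w * e k)) - 1 - w ^ 2 / 2 =
        ∑ k, (p k : ℂ) * (Complex.exp (w * e k) -
          ∑ i ∈ Finset.range (2 + 1), (w * e k) ^ i / (i.factorial : ℂ)) := by
      intro w
      have hp1' : ∑ k, (p k : ℂ) = 1 := by exact_mod_cast hp1
      have he1' : ∑ k, (p k : ℂ) * e k = 0 := by exact_mod_cast he1
      have he2' : ∑ k, (p k : ℂ) * (e k : ℂ) ^ 2 = 1 := by exact_mod_cast he2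
      have h2 : ∀ k, (p k : ℂ) * (Complex.exp (w * e k) -
          ∑ i ∈ Finset.range (2 + 1), (w * e k) ^ i / (i.factorial : ℂ)) =
          (p k : ℂ) * Complex.exp (w * e k) - p k - w * (p k * e k) -
            w ^ 2 / 2 * (p k * (e k : ℂ) ^ 2) := by
        intro k
        simp [Finset.sum_range_succ, Nat.factorial]
        ring
      simp only [h2, Finset.sum_sub_distrib, ← Finset.mul_sum, hp1', he1', he2']
      ring
    simp only [h1]
    refine Asymptotics.IsLittleO.fun_sum fun k _ => Asymptotics.IsLittleO.const_mul_left ?_ _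
    have h3 : Filter.Tendsto (fun w : ℂ => w * e k) (nhds 0) (nhds 0) := by
      simpa using (continuous_mul_const (e k : ℂ)).tendsto 0
    refine ((Complex.exp_sub_sum_range_succ_isLittleO_pow 2).comp_tendsto h3).trans_isBigO ?_
    simp only [Function.comp_def, mul_pow]
    exact (Asymptotics.isBigO_refl _ _).mul (Asymptotics.isBigO_const_const _ one_ne_zero _) |>.congr_right
      (by simp)
  have hexp' : (fun w => Complex.exp (L w) - 1 - w ^ 2 / 2) =o[nhds 0] fun w => w ^ 2 := by
    refine hφ.congr' ?_ Filter.EventuallyEq.rfl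
    filter_upwards [Metric.ball_mem_nhds (0 : ℂ) hr] with w hw
    rw [hexp w hw]
  have hLt : Filter.Tendsto L (nhds 0) (nhds 0) := by
    have := (hL.differentiableAt (Metric.ball_mem_nhds 0 hr)).continuousAt.tendsto
    rwa [hL0] at this
  -- Since L → 0, L is equivalent to exp L − 1 = O(w²); the error exp L − 1 − L is therefore o(w²),
  -- and the expansion passes from exp L to L.
  have h1 : (fun w => Complex.exp (L w) - 1 - L w) =o[nhds 0] L := by
    have := (Complex.exp_sub_sum_range_succ_isLittleO_pow 1).comp_tendsto hLt
    simpa [Function.comp_def, Finset.sum_range_succ, sub_sub] using this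
  have hsq : (fun w : ℂ => w ^ 2 / 2) =O[nhds 0] fun w => w ^ 2 := by
    simpa [div_eq_inv_mul] using (Asymptotics.isBigO_refl (fun w : ℂ => w ^ 2) (nhds 0)).const_mul_left (2⁻¹ : ℂ)
  have h2 : L =O[nhds 0] fun w => w ^ 2 := by
    have h3 : (fun w => Complex.exp (L w) - 1) =O[nhds 0] fun w => w ^ 2 := by
      simpa using hexp'.isBigO.add hsq
    have h4 : L =O[nhds 0] fun w => Complex.exp (L w) - 1 :=
      Asymptotics.IsEquivalent.isBigO_symm (u := fun w => Complex.exp (L w) - 1) h1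
    exact h4.trans h3
  have h5 : (fun w => L w - w ^ 2 / 2) =o[nhds 0] fun w => w ^ 2 :=
    (hexp'.sub (h1.trans_isBigO h2)).congr_left fun w => by ring
  have hdiff : DifferentiableOn ℂ (fun w => L w - w ^ 2 / 2) (Metric.ball 0 r) :=
    hL.sub (by fun_prop)
  -- Schwarz lemma for a function that is o(w²): analyticity makes it vanish to order 3, hence the
  -- cube.
  have h6 := Complex.dist_le_mul_div_pow_of_mapsTo_ball_of_isLittleO (n := 2) (R₂ := M + r ^ 2 / 2)
    hdiff (fun w hw => ?_) ?_ hw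
  · simpa [hL0] using h6
  · simp only [hL0, mem_closedBall_iff_norm]
    have h7 : ‖w‖ < r := by simpa using hw
    have h8 : ‖w ^ 2 / 2‖ ≤ r ^ 2 / 2 := by
      rw [norm_div, norm_pow, Complex.norm_two]; gcongr
    have h9 := norm_sub_le (L w) (w ^ 2 / 2)
    have h10 := hM w hw
    simpa using (by linarith : ‖L w - w ^ 2 / 2‖ ≤ M + r ^ 2 / 2)
  · simp only [hL0]
    refine (h5.norm_right.congr_right fun w => by simp).congr_left fun w => by simp

/-- With u = z + t²/2, |exp u − 1| ≤ |u| exp |u|, and the growth exp(t²/4) uses up only half of the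
Gaussian decay. -/
theorem norm_exp_sub_exp_le {t : ℝ} {z : ℂ} (h : ‖z + t ^ 2 / 2‖ ≤ t ^ 2 / 4) :
    ‖Complex.exp z - Complex.exp (-t ^ 2 / 2)‖ ≤ ‖z + t ^ 2 / 2‖ * Real.exp (-(1 / 4) * t ^ 2) := by
  have h1 : Complex.exp z - Complex.exp (-t ^ 2 / 2) =
      Complex.exp ((-t ^ 2 / 2 : ℝ) : ℂ) * (Complex.exp (z + t ^ 2 / 2) - 1) := by
    rw [mul_sub, ← Complex.exp_add]
    push_cast
    ring_nf
  have h2 := Complex.norm_exp_sub_sum_le_norm_mul_exp (z + t ^ 2 / 2) 1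
  simp only [Finset.range_one, Finset.sum_singleton, pow_zero, Nat.factorial_zero, Nat.cast_one,
    div_one, pow_one] at h2
  rw [h1, norm_mul, Complex.norm_exp_ofReal]
  calc _ ≤ Real.exp (-t ^ 2 / 2) * (‖z + t ^ 2 / 2‖ * Real.exp (t ^ 2 / 4)) := by
        gcongr
        exact h2.trans (by gcongr)
    _ = _ := by
        rw [mul_left_comm, ← Real.exp_add]
        ring_nf

/-- The Berry–Esseen bound from the existence of an analytic logarithm of the moment generating
function that is at most of size `N` on a disc of radius of order `√N`. -/
theorem exists_abs_sum_sub_gaussianCumulative_le (b : ℝ) (hb : 0 < b) :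
    ∃ K : ℝ, 0 < K ∧ ∀ (N : ℝ) (_ : 1 ≤ N) (ι : Type v) [Fintype ι] (p e : ι → ℝ) (L : ℂ → ℂ),
      (∀ k, 0 ≤ p k) → ∑ k, p k = 1 → ∑ k, p k * e k = 0 → ∑ k, p k * e k ^ 2 = 1 →
      DifferentiableOn ℂ L (Metric.ball 0 (b * √N)) → L 0 = 0 →
      (∀ w ∈ Metric.ball (0 : ℂ) (b * √N), ‖L w‖ ≤ N) →
      (∀ w ∈ Metric.ball (0 : ℂ) (b * √N),
        Complex.exp (L w) = ∑ k, (p k : ℂ) * Complex.exp (w * e k)) →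
      ∀ y, |∑ k with e k ≤ y, p k - gaussianCumulative y| ≤ K / √N := by
  obtain ⟨C, hC, hess⟩ := exists_abs_cdf_sub_le_of_charFun
  -- With M = N and r = b√N the Taylor bound becomes C₁|w|³/√N.
  set C₁ := (1 + b ^ 2 / 2) / b ^ 3 with hC₁
  have hC₁pos : 0 < C₁ := by positivity
  -- For t ≤ τ√N the point it stays in the disc and C₁t³/√N ≤ t²/4.
  set τ := min (b / 2) (1 / (4 * C₁)) with hτ
  have hτpos : 0 < τ := by positivity
  have hτ1 : τ ≤ b / 2 := min_le_left _ _
  have hτ2 : C₁ * τ ≤ 1 / 4 := by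
    have := mul_le_mul_of_nonneg_left (min_le_right (b / 2) (1 / (4 * C₁))) hC₁pos.le
    refine this.trans (le_of_eq ?_)
    field_simp
  set g : ℝ → ℝ := fun x => x ^ 2 * Real.exp (-(1 / 4) * x ^ 2) with hg
  have hgint : Integrable g := by
    have := integrable_rpow_mul_exp_neg_mul_sq (b := 1 / 4) (by norm_num) (s := 2) (by norm_num)
    simpa only [Real.rpow_two] using this
  have hg0 : ∀ x, 0 ≤ g x := fun x => by positivity
  have hgM : 0 ≤ ∫ x, g x := integral_nonneg hg0
  refine ⟨C * (1 / τ + C₁ * ∫ x, g x), by positivity, ?_⟩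
  intro N hN ι _ p e L hp hp1 he1 he2 hL hL0 hLN hexp y
  have hN0 : 0 < √N := Real.sqrt_pos.2 (by linarith)
  have hNsq : √N ^ 2 = N := Real.sq_sqrt (by linarith)
  have := isProbabilityMeasure_finiteMeasure e hp hp1
  have hgauss : Integrable id (ProbabilityTheory.gaussianReal 0 1) :=
    (ProbabilityTheory.memLp_id_gaussianReal 1).integrable (by simp)
  have h1 := hess (finiteMeasure p e) (ProbabilityTheory.gaussianReal 0 1) 1 (τ * √N)
    (fun t => C₁ / √N * g t) zero_le_one (by positivity) (integrable_finiteMeasure e id) hgauss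
    gaussianReal_Iic_sub_le (by fun_prop) (fun t ht => ?_) y
  · rw [finiteMeasure_real_Iic e hp, ← gaussianCumulative_eq] at h1
    refine h1.trans ?_
    have h2 : ∫ t in (0 : ℝ)..τ * √N, g t ≤ ∫ x, g x := by
      rw [intervalIntegral.integral_of_le (by positivity)]
      exact setIntegral_le_integral hgint (Filter.Eventually.of_forall hg0)
    rw [intervalIntegral.integral_const_mul]
    calc _ ≤ C * (1 / (τ * √N) + C₁ / √N * ∫ x, g x) := by gcongr
      _ = _ := by field_simp
  · have hw : (t * Complex.I : ℂ) ∈ Metric.ball (0 : ℂ) (b * √N) := by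
      have : t < b * √N := by nlinarith [ht.2]
      simpa [abs_of_pos ht.1] using this
    have h2 := norm_log_mgf_sub_le hp1 he1 he2 (by positivity) hL hL0 hLN hexp hw
    have h3 : (N + (b * √N) ^ 2 / 2) * (‖(t * Complex.I : ℂ)‖ / (b * √N)) ^ 3 = C₁ / √N * t ^ 3 := by
      rw [norm_mul, Complex.norm_I, mul_one, Complex.norm_real, Real.norm_of_nonneg ht.1.le, hC₁]
      have aux : ∀ s : ℝ, 0 < s → (s ^ 2 + (b * s) ^ 2 / 2) * (t / (b * s)) ^ 3 =
          (1 + b ^ 2 / 2) / b ^ 3 / s * t ^ 3 := fun s hs => by field_simp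
      rw [← aux _ hN0, hNsq]
    have h4 : L (t * Complex.I) - (t * Complex.I) ^ 2 / 2 = L (t * Complex.I) + t ^ 2 / 2 := by
      rw [mul_pow, Complex.I_sq]; ring
    rw [h3, h4] at h2
    have h5 : C₁ / √N * t ^ 3 ≤ t ^ 2 / 4 := by
      have h6 : C₁ / √N * t ≤ 1 / 4 := by
        calc C₁ / √N * t ≤ C₁ / √N * (τ * √N) := by gcongr; exact ht.2
          _ = C₁ * τ := by field_simp
          _ ≤ _ := hτ2
      nlinarith [sq_nonneg t]
    rw [charFun_finiteMeasure e hp, ← hexp _ hw, ProbabilityTheory.charFun_gaussianReal]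
    have h6 := norm_exp_sub_exp_le (h2.trans h5)
    have h7 : (t * (0 : ℝ) * Complex.I - ((1 : NNReal) : ℝ) * t ^ 2 / 2 : ℂ) = -t ^ 2 / 2 := by
      simp [neg_div]
    rw [h7]
    refine h6.trans ?_
    calc _ ≤ C₁ / √N * t ^ 3 * Real.exp (-(1 / 4) * t ^ 2) := by gcongr
      _ = t * (C₁ / √N * g t) := by rw [hg]; ring

end BerryEsseen
-- Analytic logarithms from slow variation.
/-- A family of functions indexed by finite sets that varies slowly has an analytic logarithm. -/
theorem exists_log_of_norm_insert_sub_le {X : Type u} [DecidableEq X] {Z : ℂ → Finset X → ℂ}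
    {r : ℝ} (hdiff : ∀ U, Differentiable ℂ fun w => Z w U) (hempty : ∀ w, Z w ∅ = 1)
    (hzero : ∀ U, Z 0 U = 1)
    (hstep : ∀ w ∈ Metric.ball (0 : ℂ) r, ∀ (U : Finset X) (j : X), j ∉ U →
      ‖Z w (insert j U) - Z w U‖ ≤ 1 / 2 * ‖Z w U‖) (U : Finset X) :
    ∃ L : ℂ → ℂ, DifferentiableOn ℂ L (Metric.ball 0 r) ∧ L 0 = 0 ∧
      ∀ w ∈ Metric.ball (0 : ℂ) r, ‖L w‖ ≤ U.card ∧ Complex.exp (L w) = Z w U := by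
  have hne : ∀ w ∈ Metric.ball (0 : ℂ) r, ∀ U, Z w U ≠ 0 := fun w hw U =>
    ne_zero_of_norm_insert_sub_le (by simp [hempty]) (hstep w hw) U
  induction U using Finset.induction_on with
  | empty =>
    exact ⟨0, differentiableOn_const 0, rfl, fun w _ => by simp [hempty]⟩
  | insert j U hj ih =>
    obtain ⟨L, hL, hL0, h⟩ := ih
    have hq : ∀ w ∈ Metric.ball (0 : ℂ) r, ‖Z w (insert j U) / Z w U - 1‖ ≤ 1 / 2 := by
      intro w hw
      have h0 := hne w hw U
      rw [div_sub_one h0, norm_div, div_le_iff₀ (norm_pos_iff.2 h0)]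
      exact hstep w hw U j hj
    refine ⟨fun w => L w + Complex.log (Z w (insert j U) / Z w U), ?_, ?_, ?_⟩
    · refine hL.add (DifferentiableOn.clog ((hdiff _).differentiableOn.div
        (hdiff _).differentiableOn fun w hw => hne w hw U) fun w hw => ?_)
      refine Complex.mem_slitPlane_of_norm_lt_one (z := Z w (insert j U) / Z w U - 1)
        ((hq w hw).trans_lt (by norm_num)) |> fun h => ?_
      simpa using h
    · simp [hL0, hzero]
    · intro w hw
      refine ⟨?_, ?_⟩
      · rw [Finset.card_insert_of_notMem hj]
        push_cast
        refine (norm_add_le _ _).trans (add_le_add (h w hw).1 ?_)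
        -- The new logarithm is at most 3/2 · 1/2 < 1, so each site adds at most 1 to the bound.
        have h1 := Complex.norm_log_one_add_half_le_self (hq w hw)
        rw [add_sub_cancel] at h1
        linarith [hq w hw]
      · rw [Complex.exp_add, (h w hw).2, Complex.exp_log (div_ne_zero (hne w hw _) (hne w hw _)),
          mul_div_cancel₀ _ (hne w hw U)]

/-! ### The outcome distribution of a measurement. -/

section Spectral

variable {n : Type v} [Fintype n] [DecidableEq n]

/-- The probability of the outcome `k` when `A` is measured in the state `ρ`. -/
noncomputable def outcomeProb (ρ : Matrix n n ℂ) {A : Matrix n n ℂ} (hA : A.IsHermitian) (k : n) : ℝ :=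
  (star (⇑(hA.eigenvectorBasis k)) ⬝ᵥ ρ.mulVec (⇑(hA.eigenvectorBasis k))).re

variable {ρ : Matrix n n ℂ} {A : Matrix n n ℂ}

theorem outcomeProb_nonneg (hρ : IsState ρ) (hA : A.IsHermitian) (k : n) : 0 ≤ outcomeProb ρ hA k :=
  (Complex.nonneg_iff.1 (hρ.1.dotProduct_mulVec_nonneg _)).1

/-- The operator that is diagonal in the eigenbasis of `A`, with given diagonal entries. -/
noncomputable abbrev spectralOperator (hA : A.IsHermitian) (c : n → ℂ) : Matrix n n ℂ :=
  Unitary.conjStarAlgAut ℂ (Matrix n n ℂ) hA.eigenvectorUnitary (Matrix.diagonal c)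

theorem average_spectralOperator (hρ : IsState ρ) (hA : A.IsHermitian) (c : n → ℂ) :
    average ρ (spectralOperator hA c) = ∑ k, (outcomeProb ρ hA k : ℂ) * c k := by
  have h1 : ∀ k, (outcomeProb ρ hA k : ℂ) =
      star (⇑(hA.eigenvectorBasis k)) ⬝ᵥ ρ.mulVec (⇑(hA.eigenvectorBasis k)) := fun k =>
    (Complex.eq_re_of_ofReal_le (r := 0) (by
      simpa using hρ.1.dotProduct_mulVec_nonneg (⇑(hA.eigenvectorBasis k)))).symm
  rw [average, spectralOperator, Unitary.conjStarAlgAut_apply, mul_assoc, mul_assoc,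
    Matrix.trace_mul_comm, mul_assoc]
  simp only [Matrix.trace, Matrix.diag_apply, Matrix.diagonal_mul, h1]
  refine Finset.sum_congr rfl fun k _ => ?_
  rw [mul_comm, mul_assoc]
  congr 1

theorem spectralOperator_eigenvalues (hA : A.IsHermitian) :
    spectralOperator hA (fun k => (hA.eigenvalues k : ℂ)) = A := hA.spectral_theorem.symm

theorem spectralOperator_exp (hA : A.IsHermitian) (c : n → ℂ) :
    NormedSpace.exp (spectralOperator hA c) = spectralOperator hA fun k => Complex.exp (c k) := by
  let := NormedAlgebra.restrictScalars ℚ ℂ (Matrix n n ℂ)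
  have hc : Continuous (Unitary.conjStarAlgAut ℂ (Matrix n n ℂ) hA.eigenvectorUnitary) :=
    ((Unitary.conjStarAlgAut ℂ (Matrix n n ℂ)
      hA.eigenvectorUnitary).toAlgEquiv.toLinearMap).continuous_of_finiteDimensional
  rw [spectralOperator, ← NormedSpace.map_exp _ hc, Matrix.exp_diagonal]
  congr 2
  funext k
  rw [Pi.coe_exp, Complex.exp_eq_exp_ℂ]

theorem sum_outcomeProb (hρ : IsState ρ) (hA : A.IsHermitian) : ∑ k, outcomeProb ρ hA k = 1 := by
  have h1 := average_spectralOperator hρ hA 1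
  have h2 : spectralOperator hA 1 = 1 := by
    rw [spectralOperator, Matrix.diagonal_one', map_one]
  rw [h2, average, one_mul, hρ.2] at h1
  simp only [Pi.one_apply, mul_one] at h1
  exact_mod_cast h1.symm

theorem average_eq_sum_outcomeProb (hρ : IsState ρ) (hA : A.IsHermitian) :
    average ρ A = ∑ k, (outcomeProb ρ hA k : ℂ) * hA.eigenvalues k := by
  conv_lhs => rw [← spectralOperator_eigenvalues hA]
  exact average_spectralOperator hρ hA _

theorem average_sq_eq_sum_outcomeProb (hρ : IsState ρ) (hA : A.IsHermitian) :
    average ρ (A ^ 2) = ∑ k, (outcomeProb ρ hA k : ℂ) * (hA.eigenvalues k : ℂ) ^ 2 := by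
  conv_lhs => rw [← spectralOperator_eigenvalues hA]
  rw [spectralOperator, ← map_pow, Matrix.diagonal_pow]
  exact average_spectralOperator hρ hA _

theorem average_exp_eq_sum_outcomeProb (hρ : IsState ρ) (hA : A.IsHermitian) (w : ℂ) :
    average ρ (NormedSpace.exp (w • A)) =
      ∑ k, (outcomeProb ρ hA k : ℂ) * Complex.exp (w * hA.eigenvalues k) := by
  conv_lhs => rw [← spectralOperator_eigenvalues hA]
  rw [spectralOperator, ← map_smul, ← Matrix.diagonal_smul]
  exact (congrArg (average ρ) (spectralOperator_exp hA _)).trans (average_spectralOperator hρ hA _)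

theorem differentiable_average_exp_smul (ρ B : Matrix n n ℂ) :
    Differentiable ℂ fun w : ℂ => average ρ (NormedSpace.exp (w • B)) :=
  fun w => ((averageHom ρ).toContinuousLinearMap.differentiableAt).comp w
    (hasDerivAt_exp_smul_const B w).differentiableAt

end Spectral

/-! ### Ball sizes and normalization of the Hamiltonian. -/

/-- A ball is its centre together with the spheres of radius 1 to R, so its size is bounded in terms
of D, R and c_D alone. -/
theorem exists_card_ball_le (D R : ℕ) (cD : ℝ) : ∃ Δ : ℕ, ∀ (X : Type u) [Fintype X]
    (d : X → X → ℕ), IsLatticeMetric d → HasDimensionBound d D cD →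
    ∀ j, (Finset.univ.filter fun i => d i j ≤ R).card ≤ Δ := by
  classical
  refine ⟨⌈1 + ∑ l ∈ Finset.Icc 1 R, cD * (l : ℝ) ^ (D - 1)⌉₊, fun X _ d hd hdim j => ?_⟩
  have h1 : (Finset.univ.filter fun i => d i j ≤ R) ⊆
      insert j ((Finset.Icc 1 R).biUnion fun l => Finset.univ.filter fun i => d i j = l) := by
    intro i hi
    simp only [Finset.mem_filter, Finset.mem_univ, true_and, Finset.mem_insert, Finset.mem_biUnion,
      Finset.mem_Icc, exists_eq_right'] at hi ⊢
    rcases Nat.eq_zero_or_pos (d i j) with h0 | h0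
    exacts [Or.inl ((hd.eq_zero_iff i j).1 h0), Or.inr ⟨h0, hi⟩]
  have h2 := (Finset.card_le_card h1).trans ((Finset.card_insert_le _ _).trans
    (Nat.add_le_add_right Finset.card_biUnion_le 1))
  rw [← Nat.cast_le (α := ℝ)]
  refine le_trans ?_ (Nat.le_ceil _)
  refine (Nat.cast_le.2 h2).trans ?_
  push_cast
  rw [add_comm]
  gcongr with l hl
  exact hdim j l (Finset.mem_Icc.1 hl).1

section Standardized

variable {n : Type v} [Fintype n] [DecidableEq n] {X : Type u} [Fintype X]

theorem standardized_eq (ρ : Matrix n n ℂ) (h : X → Matrix n n ℂ) :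
    standardized ρ h = ((stdDev ρ (hamiltonian h) : ℂ))⁻¹ •
      (hamiltonian h - average ρ (hamiltonian h) • (1 : Matrix n n ℂ)) := by
  simp only [standardized, hamiltonian, average, Finset.sum_sub_distrib, Finset.sum_mul,
    Matrix.trace_sum, Finset.sum_smul]

theorem average_standardized {ρ : Matrix n n ℂ} (hρ : IsState ρ) (h : X → Matrix n n ℂ) :
    average ρ (standardized ρ h) = 0 := by
  rw [standardized_eq, ← averageHom_apply, map_smul, map_sub, map_smul, averageHom_apply,
    averageHom_apply]
  have : average ρ (1 : Matrix n n ℂ) = 1 := by rw [average, one_mul, hρ.2]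
  simp [this]

theorem re_average_standardized_sq {ρ : Matrix n n ℂ} (h : X → Matrix n n ℂ)
    (hpos : 0 < variance ρ (hamiltonian h)) :
    (average ρ (standardized ρ h ^ 2)).re = 1 := by
  have hs : stdDev ρ (hamiltonian h) ^ 2 = variance ρ (hamiltonian h) := Real.sq_sqrt hpos.le
  rw [standardized_eq, smul_pow, ← averageHom_apply, map_smul, averageHom_apply, smul_eq_mul,
    ← Complex.ofReal_inv, ← Complex.ofReal_pow, Complex.re_ofReal_mul, inv_pow, hs]
  exact inv_mul_cancel₀ hpos.ne'

end Standardized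

theorem norm_sub_average_smul_one_le {n : Type v} [Fintype n] [DecidableEq n] {ρ : Matrix n n ℂ}
    (hρ : IsState ρ) (A : Matrix n n ℂ) :
    ‖A - average ρ A • (1 : Matrix n n ℂ)‖ ≤ 2 * ‖A‖ := by
  have := nonempty_of_isState hρ
  have h1 := norm_sub_le A (average ρ A • (1 : Matrix n n ℂ))
  rw [norm_smul, norm_one, mul_one] at h1
  linarith [norm_average_le hρ A]

end QuantumLattice

/-! ### Assembly of the theorem. -/

open QuantumLattice in
theorem theorem1 (D : ℕ) (hD : 1 ≤ D) (cD : ℝ) (hcD : 0 < cD) (R : ℕ)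
    (c₀ : ℝ) (hc₀ : 0 < c₀) :
    ∃ K : ℝ, 0 < K ∧
      ∀ (X : Type u) [Fintype X] [DecidableEq X] [Nonempty X] (d : X → X → ℕ)
        (_ : QuantumLattice.IsLatticeMetric d)
        (_ : QuantumLattice.HasDimensionBound d D cD)
        (κ : X → Type v) [∀ i, Fintype (κ i)] [∀ i, DecidableEq (κ i)]
        (ρ : ∀ i, Matrix (κ i) (κ i) ℂ) (hρ : ∀ i, QuantumLattice.IsState (ρ i))
        (E : ℝ) (_ : 0 < E)
        (h : X → QuantumLattice.Operator κ)
        (hH : (QuantumLattice.hamiltonian h).IsHermitian)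
        (_ : ∀ j, QuantumLattice.IsLocalAt d R j (h j))
        (_ : ∀ j, ‖h j‖ ≤ E)
        (_ : c₀ * E ^ 2 * (Fintype.card X : ℝ) ≤
          QuantumLattice.variance (QuantumLattice.productState ρ) (QuantumLattice.hamiltonian h)),
        QuantumLattice.kolmogorovDist
            (QuantumLattice.cumulative (QuantumLattice.productState ρ)
              (QuantumLattice.standardized_isHermitian
                (QuantumLattice.productState_isHermitian (fun i => (hρ i).1.isHermitian)) hH))
            QuantumLattice.gaussianCumulative
          ≤ ENNReal.ofReal (K / Real.sqrt (Fintype.card X : ℝ)) := by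
  obtain ⟨Δ, hΔ⟩ := exists_card_ball_le.{u} D (2 * R) cD
  obtain ⟨r, hr, hr'⟩ : ∃ r : ℝ, 0 < r ∧ (Real.exp r - 1) * 4 ^ Δ ≤ 1 / 2 := by
    refine ⟨Real.log (1 + 1 / (2 * 4 ^ Δ)), Real.log_pos (by simp), ?_⟩
    rw [Real.exp_log (by positivity), add_sub_cancel_left]
    apply le_of_eq
    field_simp
  -- Centring at most doubles ‖h_j‖ and σ ≥ √c₀ E √N, so b = r√c₀/2 ensures ‖w h'_j‖ ≤ r for |w| <
  -- b√N.
  obtain ⟨K, hK, hBE⟩ := exists_abs_sum_sub_gaussianCumulative_le.{max u v} (r * √c₀ / 2)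
    (by positivity)
  refine ⟨K, hK, ?_⟩
  intro X _ _ _ d hd hdim κ _ _ ρ hρ E hE h hH hloc hnorm hvar
  have hst := isState_productState hρ
  set P := productState ρ with hP
  set N : ℝ := (Fintype.card X : ℝ) with hN
  have hN1 : 1 ≤ N := by rw [hN]; exact_mod_cast Fintype.card_pos
  have hvpos : 0 < variance P (hamiltonian h) := lt_of_lt_of_le (by positivity) hvar
  set σ := stdDev P (hamiltonian h) with hσ
  have hσpos : 0 < σ := Real.sqrt_pos.2 hvpos
  have hσle : √c₀ * E * √N ≤ σ := by
    refine Real.le_sqrt_of_sq_le (le_of_eq_of_le ?_ hvar)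
    rw [mul_pow, mul_pow, Real.sq_sqrt hc₀.le, Real.sq_sqrt (by linarith)]
  have hA : (standardized P h).IsHermitian := standardized_isHermitian
    (productState_isHermitian (fun i => (hρ i).1.isHermitian)) hH
  let h' : X → Operator κ := fun j => (σ : ℂ)⁻¹ • (h j - average P (h j) • (1 : Operator κ))
  have hsum : ∑ j, h' j = standardized P h := by
    rw [standardized, ← Finset.smul_sum]
  have hloc' : ∀ (w : ℂ) j, IsLocalAt d R j (w • h' j) := fun w j =>
    (((hloc j).sub_smul_one _).smul _).smul _
  have hnorm' : ∀ w ∈ Metric.ball (0 : ℂ) (r * √c₀ / 2 * √N), ∀ j, ‖w • h' j‖ ≤ r := by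
    intro w hw j
    have hw' : ‖w‖ ≤ r * √c₀ / 2 * √N := by simpa using (mem_ball_zero_iff.1 hw).le
    rw [norm_smul, norm_smul, norm_inv, Complex.norm_real, Real.norm_of_nonneg hσpos.le]
    have h1 : ‖h j - average P (h j) • (1 : Operator κ)‖ ≤ 2 * E :=
      (norm_sub_average_smul_one_le hst _).trans (by linarith [hnorm j])
    calc _ ≤ r * √c₀ / 2 * √N * (σ⁻¹ * (2 * E)) := by gcongr
      _ = r * (√c₀ * E * √N) / σ := by field_simp
      _ ≤ r * σ / σ := by gcongr
      _ = r := by field_simp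
  obtain ⟨L, hL, hL0, hLw⟩ := exists_log_of_norm_insert_sub_le (r := r * √c₀ / 2 * √N)
    (Z := fun w U => average P (NormedSpace.exp (∑ j ∈ U, w • h' j)))
    (fun U => by
      simp only [← Finset.smul_sum]
      exact differentiable_average_exp_smul _ _)
    (fun w => by simp [average, hst.2])
    (fun U => by simp [average, hst.2])
    (fun w hw U j hj => average_exp_insert_sub_le hd (hΔ X d hd hdim) hρ hr.le hr' (hloc' w)
      (hnorm' w hw) U j hj) Finset.univ
  have h0 := average_eq_sum_outcomeProb hst hA
  rw [average_standardized hst] at h0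
  have h2 := re_average_standardized_sq h hvpos
  rw [average_sq_eq_sum_outcomeProb hst hA] at h2
  refine iSup_le fun y => ENNReal.ofReal_le_ofReal ?_
  refine hBE N hN1 (∀ i, κ i) (outcomeProb P hA) hA.eigenvalues L (outcomeProb_nonneg hst hA)
    (sum_outcomeProb hst hA) (by exact_mod_cast h0.symm) (by exact_mod_cast h2) hL hL0
    (fun w hw => ?_) (fun w hw => ?_) y
  · simpa [hN] using (hLw w hw).1
  · rw [(hLw w hw).2, ← Finset.smul_sum, hsum, average_exp_eq_sum_outcomeProb hst hA]
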